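/- Let $p4mm=\mathbb Z^2\rtimes O(2,\mathbb Z)$ be the space group of the square lattice, with translations $T_x,T_y$ and reflections $P_x:(x,y)\mapsto(-x,y)$, $P_{xy}:(x,y)\mapsto(y,x)$. Let $\mathbb Z_2^T=\{1,\mathcal T\}$ and $G'=p4mm\times\mathbb Z_2^T$, the group that accompanies $\mathrm U(1)$ in $G=(\mathrm U(1)\rtimes\mathbb Z_2^T)\times p4mm$. Let $u(g)=-1$ if $g$ contains $\mathcal T$ and $u(g)=1$ otherwise. Let $s:G'\to\{\pm1\}$ be the homomorphism with $s(T_x)=s(T_y)=1$, $s(P_x)=s(P_{xy})=s(\mathcal T)=-1$, and put $t=su$; thus $t(T_x)=t(T_y)=t(\mathcal T)=1$ and $t(P_x)=t(P_{xy})=-1$. For an abelian group $M$ (written multiplicatively), a $t$-twisted $M$-valued factor set is a map $\omega:G'\times G'\to M$ with $\omega(g,h)\,\omega(gh,k)=\omega(g,hk)\,\omega(h,k)^{t(g)}$. The group $H^2_t(G',M)$ is the group of these modulo the maps $(g,h)\mapsto\lambda(g)\lambda(h)^{t(g)}\lambda(gh)^{-1}$. The extension of $G'$ by $M$ defined by $\omega$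 is $M\times G'$ with product $(a,g)(b,h)=(a\,b^{t(g)}\,\omega(g,h),gh)$, in which $M$ is embedded by $a\mapsto(a\,\omega(1,1)^{-1},1)$. Write $H^2(G',\mathbb Z_2)$ for the untwisted group with $M=\mathbb Z_2=\{\pm1\}$, and let $\rho_2:H^2(G',\mathbb Z_2)\to H^2_t(G',\mathrm U(1))$ be induced by $\{\pm1\}\subset\mathrm U(1)$. Let $\mathbb Z_{2n}\subset\mathrm U(1)$ be the $2n$-th roots of unity. A $\mathbb Z_2$ factor set $\omega$ is anomaly-negative if for every even $n\ge2$ there is a $t$-twisted $\mathbb Z_{2n}$ factor set $\phi_n$ with $\omega(g,h)=\phi_n(g,h)^n$ for all $g,h\in G'$. Let $\mathcal N\subset H^2(G',\mathbb Z_2)$ be the subgroup of classes of anomaly-negative factor sets, and $\mathcal S=H^2(G',\mathbb Z_2)/\mathcal N$. Lift the generators to elements of the extension defined by a factor set, denoted by the same letters, with the lift of $T_y$ equal to $P_{xy}T_xP_{xy}$. Consider the relations $$T_xT_yT_x^{-1}T_y^{-1}=\alpha_{txty},\quad T_yP_xT_y^{-1}P_x=\alpha_{typx},\quad P_x^2=\alpha_{px},\quad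 T_xP_xT_xP_x=\alpha_{txpx},\quad P_{xy}^2=\alpha_{pxy},$$ $$(P_xP_{xy})^4=\alpha_{pxpxy},\quad \mathcal T^2=\alpha_T,\quad \mathcal TT_x=\alpha_{Ttx}T_x\mathcal T,\quad \mathcal TP_x=\alpha_{Tpx}P_x\mathcal T,\quad \mathcal TP_{xy}=\alpha_{Tpxy}P_{xy}\mathcal T .$$ Then: (1) $H^2(G',\mathbb Z_2)\cong\mathbb Z_2^{10}$. For $\mathbb Z_2$ factor sets such lifts exist, the ten phases, now written $\sigma$, do not depend on the lifts, and they define an isomorphism $H^2(G',\mathbb Z_2)\to\{\pm1\}^{10}$. (2) $H^2_t(G',\mathrm U(1))\cong\mathrm U(1)\times\mathbb Z_2^6$ as groups. For every $t$-twisted $\mathrm U(1)$ factor set, lifts with $\alpha_{typx}=\alpha_{pxpxy}=\alpha_T=1$ exist, the other phases do not depend on the choice of such lifts, and $(\alpha_{txty};\alpha_{px},\alpha_{txpx},\alpha_{pxy},\alpha_{Ttx},\alpha'_{Tpx},\alpha'_{Tpxy})$ defines an isomorphism $H^2_t(G',\mathrm U(1))\to\mathrm U(1)\times\{\pm1\}^6$.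 Here $\alpha'_{Tpx},\alpha'_{Tpxy}$ are the values of $\alpha_{Tpx},\alpha_{Tpxy}$ for such lifts. (3) In these coordinates $\rho_2$ sends a class with parameters $\sigma$ to $$(\sigma_{txty};\sigma_{px},\sigma_{txpx},\sigma_{pxy},\sigma_{Ttx},\sigma_T\sigma_{Tpx},\sigma_T\sigma_{Tpxy}).$$ (4) A class in $H^2(G',\mathbb Z_2)$ lies in $\mathcal N$ if and only if $\sigma_{px}=\sigma_{txpx}=\sigma_{pxy}=\sigma_{Ttx}=\sigma_T\sigma_{Tpx}=\sigma_T\sigma_{Tpxy}=1$. A $\mathbb Z_2$ factor set is anomaly-negative if and only if its class lies in $\mathcal N$. Moreover $\mathcal N\cong\mathbb Z_2^4$ and $\mathcal S\cong\mathbb Z_2^6$. -/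

import Mathlib

namespace FluxFusion

/-! ### Twisted factor sets and twisted second cohomology -/

/-- The group `Z²_t(G, M)` of `t`-twisted `M`-valued factor sets (2-cocycles), where `g` acts on the
abelian group `M` by `a ↦ a ^ t(g)`. -/
def cocycles₂ {G : Type*} [Group G] (t : G →* ℤˣ) (M : Type*) [CommGroup M] :
    Subgroup (G × G → M) where
  carrier := {ω | ∀ g h k, ω (g, h) * ω (g * h, k) = ω (g, h * k) * ω (h, k) ^ (t g : ℤ)}
  mul_mem' := by
    intro a b ha hb g h k
    simp only [Pi.mul_apply, mul_zpow]
    rw [mul_mul_mul_comm, ha g h k, hb g h k, mul_mul_mul_comm]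
  one_mem' := by
    intro g h k
    simp
  inv_mem' := by
    intro a ha g h k
    simp only [Pi.inv_apply, inv_zpow, ← mul_inv]
    rw [ha g h k]

/-- The coboundary `(g₁, g₂) ↦ λ(g₁) λ(g₂)^{t(g₁)} λ(g₁ g₂)⁻¹` of a 1-cochain `λ : G → M`. -/
def coboundary₁ {G : Type*} [Group G] (t : G →* ℤˣ) (M : Type*) [CommGroup M] :
    (G → M) →* (G × G → M) where
  toFun l := fun p => l p.1 * l p.2 ^ (t p.1 : ℤ) * (l (p.1 * p.2))⁻¹
  map_one' := by
    funext p
    simp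
  map_mul' := by
    intro a b
    funext p
    simp only [Pi.mul_apply, mul_zpow, mul_inv]
    rw [mul_mul_mul_comm (a p.1), mul_mul_mul_comm]

/-- The group `B²_t(G, M)` of 2-coboundaries, as a subgroup of `Z²_t(G, M)`. -/
def coboundaries₂ {G : Type*} [Group G] (t : G →* ℤˣ) (M : Type*) [CommGroup M] :
    Subgroup (cocycles₂ t M) :=
  (coboundary₁ t M).range.subgroupOf (cocycles₂ t M)

/-- `H²_t(G, M) = Z²_t(G, M) / B²_t(G, M)`. -/
abbrev H2 {G : Type*} [Group G] (t : G →* ℤˣ) (M : Type*) [CommGroup M] : Type _ :=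
  cocycles₂ t M ⧸ coboundaries₂ t M

/-- The class of a factor set. -/
abbrev cls {G : Type*} [Group G] {t : G →* ℤˣ} {M : Type*} [CommGroup M] (ω : cocycles₂ t M) :
    H2 t M :=
  QuotientGroup.mk ω

/-- The action of `G` on `M` by `g • a = a ^ t(g)`. -/
abbrev twistAction {G : Type*} [Group G] (t : G →* ℤˣ) (M : Type*) [CommGroup M] :
    MulDistribMulAction G M where
  smul g a := a ^ (t g : ℤ)
  one_smul a := by
    change a ^ ((t 1 : ℤˣ) : ℤ) = a
    simp
  mul_smul g h a := by
    change a ^ ((t (g * h) : ℤˣ) : ℤ) = (a ^ (t h : ℤ)) ^ (t g : ℤ)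
    rw [map_mul, Units.val_mul, mul_comm, zpow_mul]
  smul_mul g a b := mul_zpow a b _
  smul_one g := one_zpow _

/-- The factor sets above are Mathlib's multiplicative 2-cocycles for the twisted action. -/
theorem mem_cocycles₂_iff {G : Type*} [Group G] (t : G →* ℤˣ) (M : Type*) [CommGroup M]
    (ω : G × G → M) :
    ω ∈ cocycles₂ t M ↔
      letI := twistAction t M
      groupCohomology.IsMulCocycle₂ ω := by
  constructor
  · intro hω g h k
    change _ = ω (h, k) ^ (t g : ℤ) * _
    rw [mul_comm (ω (g * h, k)), hω g h k, mul_comm]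
  · intro hω g h k
    have := hω g h k
    change _ = ω (h, k) ^ (t g : ℤ) * _ at this
    rw [mul_comm, this, mul_comm]

/-- The coboundaries above are Mathlib's multiplicative 2-coboundaries for the twisted action. -/
theorem mem_coboundaries₂_iff {G : Type*} [Group G] (t : G →* ℤˣ) (M : Type*) [CommGroup M]
    (ω : cocycles₂ t M) :
    ω ∈ coboundaries₂ t M ↔
      letI := twistAction t M
      groupCohomology.IsMulCoboundary₂ ω.1 := by
  have key : ∀ (l : G → M) (g h : G), coboundary₁ t M l (g, h) =
      l h ^ (t g : ℤ) / l (g * h) * l g := by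
    intro l g h
    change l g * l h ^ (t g : ℤ) * (l (g * h))⁻¹ = _
    rw [div_eq_mul_inv, mul_comm (l g), mul_right_comm]
  constructor
  · rintro ⟨l, hl⟩
    refine ⟨l, fun g h => ?_⟩
    change l h ^ (t g : ℤ) / l (g * h) * l g = _
    rw [← key]
    exact congrFun hl (g, h)
  · rintro ⟨l, hl⟩
    refine ⟨l, ?_⟩
    funext p
    obtain ⟨g, h⟩ := p
    rw [key]
    exact hl g h

/-! ### The group extension defined by a factor set -/

/-- The `t`-twisted extension of `G` by `M` attached to the factor set `ω`: pairs `(a, g)` with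
`(a₁, g₁) (a₂, g₂) = (a₁ a₂^{t(g₁)} ω(g₁, g₂), g₁ g₂)`. -/
@[ext] structure Extension {G : Type*} [Group G] {t : G →* ℤˣ} {M : Type*} [CommGroup M]
    (ω : cocycles₂ t M) where
  coeff : M
  elt : G

namespace Extension

variable {G : Type*} [Group G] {t : G →* ℤˣ} {M : Type*} [CommGroup M] (ω : cocycles₂ t M)

instance : Mul (Extension ω) :=
  ⟨fun x y => ⟨x.coeff * y.coeff ^ (t x.elt : ℤ) * ω.1 (x.elt, y.elt), x.elt * y.elt⟩⟩

instance : One (Extension ω) := ⟨⟨(ω.1 (1, 1))⁻¹, 1⟩⟩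

instance : Inv (Extension ω) :=
  ⟨fun x => ⟨(ω.1 (1, 1))⁻¹ * (ω.1 (x.elt⁻¹, x.elt))⁻¹ * (x.coeff ^ (t x.elt⁻¹ : ℤ))⁻¹, x.elt⁻¹⟩⟩

theorem mul_def (x y : Extension ω) :
    x * y = ⟨x.coeff * y.coeff ^ (t x.elt : ℤ) * ω.1 (x.elt, y.elt), x.elt * y.elt⟩ := rfl

theorem one_def : (1 : Extension ω) = ⟨(ω.1 (1, 1))⁻¹, 1⟩ := rfl

theorem inv_def (x : Extension ω) :
    x⁻¹ = ⟨(ω.1 (1, 1))⁻¹ * (ω.1 (x.elt⁻¹, x.elt))⁻¹ * (x.coeff ^ (t x.elt⁻¹ : ℤ))⁻¹,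
      x.elt⁻¹⟩ := rfl

theorem cocycle_one_left (g : G) : ω.1 (1, g) = ω.1 (1, 1) := by
  have h := ω.2 1 1 g
  simp only [one_mul, mul_one, map_one, Units.val_one, zpow_one] at h
  exact (mul_right_cancel h).symm

instance : Group (Extension ω) :=
  Group.ofLeftAxioms
    (by
      intro x y z
      have h := ω.2 x.elt y.elt z.elt
      ext
      · simp only [mul_def, map_mul, Units.val_mul, mul_zpow, zpow_mul]
        rw [← zpow_mul, mul_comm (t x.elt : ℤ), zpow_mul]
        calc _ = x.coeff * y.coeff ^ (t x.elt : ℤ) * (z.coeff ^ (t y.elt : ℤ)) ^ (t x.elt : ℤ) *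
                  (ω.1 (x.elt, y.elt) * ω.1 (x.elt * y.elt, z.elt)) := by
              ac_rfl
          _ = _ := by
              rw [h]
              ac_rfl
      · simp only [mul_def, mul_assoc])
    (by
      intro x
      ext
      · simp [mul_def, one_def, cocycle_one_left, mul_comm]
      · simp [mul_def, one_def])
    (by
      intro x
      ext
      · simp [mul_def, one_def, inv_def, mul_comm, mul_left_comm]
      · simp [mul_def, one_def, inv_def])

/-- The inclusion of the coefficient group, `a ↦ (a ω(1,1)⁻¹, 1)`. -/
def incl : M →* Extension ω where
  toFun a := ⟨a * (ω.1 (1, 1))⁻¹, 1⟩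
  map_one' := by
    ext <;> simp [one_def]
  map_mul' a b := by
    ext
    · simp [mul_def, mul_assoc]
      exact mul_comm _ _
    · simp [mul_def]

/-- The projection onto `G`. -/
def proj : Extension ω →* G where
  toFun x := x.elt
  map_one' := rfl
  map_mul' _ _ := rfl

end Extension

/-! ### Coefficients, the map `ρ₂`, and the anomaly test -/

/-- `ℤ_N` as the group of complex `N`-th roots of unity inside `U(1)`. -/
noncomputable def mu (N : ℕ) : Subgroup Circle := (powMonoidHom N : Circle →* Circle).ker

theorem mu_two_zpow (a : mu 2) (e : ℤˣ) : (a : Circle) ^ (e : ℤ) = a := by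
  rcases Int.units_eq_one_or e with rfl | rfl
  · simp
  · have h : (a : Circle) ^ 2 = 1 := a.2
    rw [Units.val_neg, Units.val_one, zpow_neg, zpow_one, inv_eq_iff_mul_eq_one, ← sq]
    exact h

/-- A `ℤ₂`-valued factor set viewed as a `t`-twisted `U(1)`-valued factor set. -/
noncomputable def inclCocycles {G : Type*} [Group G] (t : G →* ℤˣ) :
    cocycles₂ (1 : G →* ℤˣ) (mu 2) →* cocycles₂ t Circle where
  toFun ω := ⟨fun p => (ω.1 p : Circle), by
    intro g h k
    have := congrArg (Subtype.val : mu 2 → Circle) (ω.2 g h k)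
    rw [mu_two_zpow]
    simpa using this⟩
  map_one' := rfl
  map_mul' _ _ := rfl

/-- `ρ₂ : H²(G, ℤ₂) → H²_t(G, U(1))`, `[ω]_{ℤ₂} ↦ [ω]_{U(1)}`. -/
noncomputable def rho2 {G : Type*} [Group G] (t : G →* ℤˣ) : H2 (1 : G →* ℤˣ) (mu 2) →* H2 t Circle :=
  QuotientGroup.map _ _ (inclCocycles t) (by
    rintro ω ⟨l, hl⟩
    refine ⟨fun g => (l g : Circle), ?_⟩
    funext p
    have := congrArg (Subtype.val : mu 2 → Circle) (congrFun hl p)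
    change (l p.1 : Circle) * (l p.2 : Circle) ^ (t p.1 : ℤ) * ((l (p.1 * p.2) : Circle))⁻¹ = _
    rw [mu_two_zpow]
    change _ = ((ω.1 p : mu 2) : Circle)
    simpa [coboundary₁] using this)

/-- The flux-fusion anomaly test is negative for the `ℤ₂` factor set `ω`: for each even `n ≥ 2`
there is a `t`-twisted `ℤ_{2n}` factor set `φ` with `ω(g,h) = φ(g,h)ⁿ`. -/
def IsAnomalyNegative {G : Type*} [Group G] (t : G →* ℤˣ)
    (ω : cocycles₂ (1 : G →* ℤˣ) (mu 2)) : Prop :=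
  ∀ n : ℕ, 2 ≤ n → Even n →
    ∃ φ : cocycles₂ t (mu (2 * n)), ∀ g h : G, (ω.1 (g, h) : Circle) = (φ.1 (g, h) : Circle) ^ n

/-- Anomaly-negative factor sets form a group. -/
noncomputable def anomalyNegativeCocycles {G : Type*} [Group G] (t : G →* ℤˣ) :
    Subgroup (cocycles₂ (1 : G →* ℤˣ) (mu 2)) where
  carrier := {ω | IsAnomalyNegative t ω}
  mul_mem' := by
    intro a b ha hb n hn he
    obtain ⟨φ, hφ⟩ := ha n hn he
    obtain ⟨ψ, hψ⟩ := hb n hn he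
    refine ⟨φ * ψ, fun g h => ?_⟩
    simp [hφ, hψ, mul_pow]
  one_mem' := by
    intro n _ _
    exact ⟨1, fun g h => by simp⟩
  inv_mem' := by
    intro a ha n hn he
    obtain ⟨φ, hφ⟩ := ha n hn he
    refine ⟨φ⁻¹, fun g h => ?_⟩
    simp [hφ]

/-- The group `𝒩 ⊆ H²(G, ℤ₂)` of anomaly-negative vison fractionalization classes. -/
noncomputable def anomalyNegative {G : Type*} [Group G] (t : G →* ℤˣ) : Subgroup (H2 (1 : G →* ℤˣ) (mu 2)) :=
  (anomalyNegativeCocycles t).map (QuotientGroup.mk' _)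

/-! ### The symmetry group `G' = p4mm × ℤ₂ᵀ` -/

/-- The action of the orthogonal group `O(2, ℤ)` (the point group of the square lattice, of
order 8) on the lattice `ℤ²`. -/
def pointAction : Matrix.orthogonalGroup (Fin 2) ℤ →* MulAut (Multiplicative (Fin 2 → ℤ)) where
  toFun A :=
    { toFun := fun v => Multiplicative.ofAdd ((A : Matrix (Fin 2) (Fin 2) ℤ).mulVec v.toAdd)
      invFun := fun v =>
        Multiplicative.ofAdd (((A⁻¹ : Matrix.orthogonalGroup (Fin 2) ℤ) :
          Matrix (Fin 2) (Fin 2) ℤ).mulVec v.toAdd)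
      left_inv := fun v => by
        simp only [toAdd_ofAdd, Matrix.mulVec_mulVec, ← Submonoid.coe_mul, inv_mul_cancel]
        simp
      right_inv := fun v => by
        simp only [toAdd_ofAdd, Matrix.mulVec_mulVec, ← Submonoid.coe_mul, mul_inv_cancel]
        simp
      map_mul' := fun v w => by
        rw [toAdd_mul, Matrix.mulVec_add, ofAdd_add] }
  map_one' := by
    ext1 v
    simp
  map_mul' A B := by
    ext1 v
    change Multiplicative.ofAdd (((A * B : Matrix.orthogonalGroup (Fin 2) ℤ) :
      Matrix (Fin 2) (Fin 2) ℤ).mulVec v.toAdd) = Multiplicative.ofAdd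
        ((A : Matrix (Fin 2) (Fin 2) ℤ).mulVec ((B : Matrix (Fin 2) (Fin 2) ℤ).mulVec v.toAdd))
    rw [Matrix.mulVec_mulVec, ← Submonoid.coe_mul]

/-- The space group of the square lattice `ℤ²`: all maps `r ↦ A r + v` with `v ∈ ℤ²` and
`A ∈ O(2, ℤ)`. -/
abbrev P4mm : Type := Multiplicative (Fin 2 → ℤ) ⋊[pointAction] Matrix.orthogonalGroup (Fin 2) ℤ

/-- `G' = p4mm × ℤ₂ᵀ`, with `ℤ₂ᵀ = {1, -1}`. -/
abbrev GPrime : Type := P4mm × ℤˣ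

/-- The determinant of the point-group part: `-1` for reflections and glides, `+1` otherwise. -/
def orientation : P4mm →* ℤˣ :=
  ((Units.map Matrix.detMonoidHom).comp Unitary.toUnits).comp SemidirectProduct.rightHom

/-- `u(g) = -1` if `g` is anti-unitary (contains time reversal) and `+1` otherwise. -/
def unitarity : GPrime →* ℤˣ := MonoidHom.snd P4mm ℤˣ

/-- `s(g) = -1` if `g` inverts the symmetry flux and `+1` otherwise; for
`(U(1) ⋊ ℤ₂ᵀ) × p4mm` the flux is inverted by reflections and by time reversal. -/
def fluxSign : GPrime →* ℤˣ := orientation.comp (MonoidHom.fst P4mm ℤˣ) * MonoidHom.snd P4mm ℤˣ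

/-- The twist `t(g) = s(g) u(g)`. -/
def twist : GPrime →* ℤˣ := fluxSign * unitarity

/-- Translation by one lattice constant along the `x`-axis. -/
def Tx : GPrime := (SemidirectProduct.inl (Multiplicative.ofAdd ![1, 0]), 1)

/-- Translation by one lattice constant along the `y`-axis. -/
def Ty : GPrime := (SemidirectProduct.inl (Multiplicative.ofAdd ![0, 1]), 1)

/-- The reflection `(x, y) ↦ (-x, y)`. -/
def Px : GPrime :=
  (SemidirectProduct.inr ⟨!![-1, 0; 0, 1], by
    rw [Matrix.mem_orthogonalGroup_iff]; decide⟩, 1)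

/-- The reflection `(x, y) ↦ (y, x)`. -/
def Pxy : GPrime :=
  (SemidirectProduct.inr ⟨!![0, 1; 1, 0], by
    rw [Matrix.mem_orthogonalGroup_iff]; decide⟩, 1)

/-- Time reversal. -/
def Tr : GPrime := (1, -1)

/-! ### Parametrization of factor sets by phases in the relations -/

/-- Labels of the phases in the defining relations of `G'`. -/
inductive RelIndex
  | txty | typx | px | txpx | pxy | pxpxy | T | Ttx | Tpx | Tpxy
  deriving DecidableEq

/-- Labels of the `ℤ₂`-valued invariants of `H²_t(G', U(1))`. -/
inductive TorIndex
  | px | txpx | pxy | Ttx | Tpx | Tpxy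
  deriving DecidableEq

/-- A choice of lifts of the generators of `G'` to the extension defined by `ω`, where the lift of
`Ty` is fixed by `Ty = Pxy Tx Pxy`. -/
structure GeneratorLifts {t : GPrime →* ℤˣ} {M : Type*} [CommGroup M] (ω : cocycles₂ t M) where
  tx : Extension ω
  ty : Extension ω
  px : Extension ω
  pxy : Extension ω
  tr : Extension ω
  proj_tx : Extension.proj ω tx = Tx
  proj_ty : Extension.proj ω ty = Ty
  proj_px : Extension.proj ω px = Px
  proj_pxy : Extension.proj ω pxy = Pxy
  proj_tr : Extension.proj ω tr = Tr
  ty_eq : ty = pxy * tx * pxy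

/-- The lifts obey the defining relations of `G'` up to the phases `α`. -/
def GeneratorLifts.Realizes {t : GPrime →* ℤˣ} {M : Type*} [CommGroup M] {ω : cocycles₂ t M}
    (L : GeneratorLifts ω) (α : RelIndex → M) : Prop :=
  L.tx * L.ty * L.tx⁻¹ * L.ty⁻¹ = Extension.incl ω (α .txty) ∧
  L.ty * L.px * L.ty⁻¹ * L.px = Extension.incl ω (α .typx) ∧
  L.px ^ 2 = Extension.incl ω (α .px) ∧
  L.tx * L.px * L.tx * L.px = Extension.incl ω (α .txpx) ∧
  L.pxy ^ 2 = Extension.incl ω (α .pxy) ∧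
  (L.px * L.pxy) ^ 4 = Extension.incl ω (α .pxpxy) ∧
  L.tr ^ 2 = Extension.incl ω (α .T) ∧
  L.tr * L.tx = Extension.incl ω (α .Ttx) * L.tx * L.tr ∧
  L.tr * L.px = Extension.incl ω (α .Tpx) * L.px * L.tr ∧
  L.tr * L.pxy = Extension.incl ω (α .Tpxy) * L.pxy * L.tr

/-- The gauge-fixed phases (those of `typx`, `pxpxy` and `T` set to `1`) with the invariants
`p = (α_txty; α_px, α_txpx, α_pxy, α_Ttx, α'_Tpx, α'_Tpxy)`. -/
noncomputable def gaugeFixed (p : Circle × (TorIndex → mu 2)) : RelIndex → Circle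
  | .txty => p.1
  | .typx => 1
  | .px => p.2 .px
  | .txpx => p.2 .txpx
  | .pxy => p.2 .pxy
  | .pxpxy => 1
  | .T => 1
  | .Ttx => p.2 .Ttx
  | .Tpx => p.2 .Tpx
  | .Tpxy => p.2 .Tpxy

end FluxFusion

open FluxFusion

/-!
A class in `H²_t(G', M)` is determined by how far lifts of the generators to the extension fail to
obey the defining relations of `G'`.

For lifts with coefficients `a`, `b`, `c`, `d`, the ten phases are explicit monomials in these
coefficients and in the values of the factor set (`phases`, `mkLifts_realizes`). The listed relations
present `G'`: if some lifts obey them exactly, the extension splits (`exists_section_of_relations`,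
proved with a normal form for the elements of `G'`). Hence a factor set is a coboundary exactly when
some lifts have trivial phases (`mem_coboundaries₂_iff_phases`).

For `M = ℤ₂` the phases do not depend on the lifts, so they embed `H²(G', ℤ₂)` into `{±1}¹⁰`. The
embedding is onto because of explicit factor sets `(-1) ^ e(g, h)` (`signRep`): four of the exponents
`e` are twisted factor sets over `ℤ` (the area exponent, and Bocksteins of the translation parity, of
the rotation angle and of the time-reversal bit), and six are cup products of characters modulo 2.

For `M = U(1)` a change of lifts rescales only the phases of `typx`, `pxpxy`, `T`, `Tpx`, `Tpxy`
(`phases_one_twist`). As `U(1)` is divisible, the first three can be made trivial, which leaves the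
invariants `torInvariants`; all of them but the first are signs, because reflections act on
`U(1)` by inversion. The area exponent with an arbitrary base realizes the first invariant, and
`ℤ₂` factor sets realize the signs.

If `ω = φ²` for a twisted `ℤ₄` factor set `φ`, then the phases of `ω` are the squares of those of `φ`,
and the relations that force signs in the twisted case give the six conditions. Conversely, under
these conditions `ω` is, up to a coboundary, a product of factor sets `s ^ e(g, h)` with signs `s`
and the four exponents `e` over `ℤ`. For these an `n`-th root is obtained by replacing `s` by one of
its `n`-th roots.
-/

namespace FluxFusion

/-! ### Coordinates on the symmetry group -/

/-- The first coordinate of the translation part. -/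
def cx (g : GPrime) : ℤ := g.1.left.toAdd 0
/-- The second coordinate of the translation part. -/
def cy (g : GPrime) : ℤ := g.1.left.toAdd 1
/-- The `(i, j)` entry of the point-group part. -/
def pt (g : GPrime) (i j : Fin 2) : ℤ := (g.1.right : Matrix (Fin 2) (Fin 2) ℤ) i j
/-- The time-reversal component, as an integer `±1`. -/
def tau (g : GPrime) : ℤ := (g.2 : ℤ)

theorem GPrime.ext_coords {g h : GPrime} (hx : cx g = cx h) (hy : cy g = cy h)
    (hp : ∀ i j, pt g i j = pt h i j) (ht : tau g = tau h) : g = h := by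
  refine Prod.ext (SemidirectProduct.ext ?_ (Subtype.ext (Matrix.ext hp))) (Units.ext ht)
  apply Multiplicative.toAdd.injective
  funext i
  fin_cases i
  · exact hx
  · exact hy

@[simp] theorem cx_one : cx 1 = 0 := rfl
@[simp] theorem cy_one : cy 1 = 0 := rfl
@[simp] theorem tau_one : tau 1 = 1 := rfl
@[simp] theorem pt_one (i j : Fin 2) : pt 1 i j = (1 : Matrix (Fin 2) (Fin 2) ℤ) i j := rfl

@[simp] theorem cx_mul (g h : GPrime) :
    cx (g * h) = cx g + (pt g 0 0 * cx h + pt g 0 1 * cy h) := by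
  change cx g + (g.1.right : Matrix (Fin 2) (Fin 2) ℤ).mulVec h.1.left.toAdd 0 = _
  rw [Matrix.mulVec, dotProduct, Fin.sum_univ_two]
  rfl

@[simp] theorem cy_mul (g h : GPrime) :
    cy (g * h) = cy g + (pt g 1 0 * cx h + pt g 1 1 * cy h) := by
  change cy g + (g.1.right : Matrix (Fin 2) (Fin 2) ℤ).mulVec h.1.left.toAdd 1 = _
  rw [Matrix.mulVec, dotProduct, Fin.sum_univ_two]
  rfl

@[simp] theorem pt_mul (g h : GPrime) (i j : Fin 2) :
    pt (g * h) i j = pt g i 0 * pt h 0 j + pt g i 1 * pt h 1 j := by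
  change (_ * _ : Matrix (Fin 2) (Fin 2) ℤ) i j = _
  rw [Matrix.mul_apply, Fin.sum_univ_two]
  rfl

@[simp] theorem tau_mul (g h : GPrime) : tau (g * h) = tau g * tau h := rfl

@[simp] theorem cx_Tx : cx Tx = 1 := rfl
@[simp] theorem cy_Tx : cy Tx = 0 := rfl
@[simp] theorem pt_Tx (i j : Fin 2) : pt Tx i j = (1 : Matrix (Fin 2) (Fin 2) ℤ) i j := rfl
@[simp] theorem tau_Tx : tau Tx = 1 := rfl
@[simp] theorem cx_Ty : cx Ty = 0 := rfl
@[simp] theorem cy_Ty : cy Ty = 1 := rfl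
@[simp] theorem pt_Ty (i j : Fin 2) : pt Ty i j = (1 : Matrix (Fin 2) (Fin 2) ℤ) i j := rfl
@[simp] theorem tau_Ty : tau Ty = 1 := rfl
@[simp] theorem cx_Px : cx Px = 0 := rfl
@[simp] theorem cy_Px : cy Px = 0 := rfl
@[simp] theorem pt_Px (i j : Fin 2) : pt Px i j = !![-1, 0; 0, 1] i j := rfl
@[simp] theorem tau_Px : tau Px = 1 := rfl
@[simp] theorem cx_Pxy : cx Pxy = 0 := rfl
@[simp] theorem cy_Pxy : cy Pxy = 0 := rfl
@[simp] theorem pt_Pxy (i j : Fin 2) : pt Pxy i j = !![0, 1; 1, 0] i j := rfl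
@[simp] theorem tau_Pxy : tau Pxy = 1 := rfl
@[simp] theorem cx_Tr : cx Tr = 0 := rfl
@[simp] theorem cy_Tr : cy Tr = 0 := rfl
@[simp] theorem pt_Tr (i j : Fin 2) : pt Tr i j = (1 : Matrix (Fin 2) (Fin 2) ℤ) i j := rfl
@[simp] theorem tau_Tr : tau Tr = -1 := rfl

theorem tau_eq (g : GPrime) : tau g = 1 ∨ tau g = -1 := by
  rcases Int.units_eq_one_or g.2 with h | h <;> simp [tau, h]

/-- The point group consists of the eight signed permutation matrices. -/
theorem pt_cases (g : GPrime) :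
    (((pt g 0 0 = 1 ∨ pt g 0 0 = -1) ∧ pt g 0 1 = 0) ∧
      pt g 1 0 = 0 ∧ (pt g 1 1 = 1 ∨ pt g 1 1 = -1)) ∨
    ((pt g 0 0 = 0 ∧ (pt g 0 1 = 1 ∨ pt g 0 1 = -1)) ∧
      (pt g 1 0 = 1 ∨ pt g 1 0 = -1) ∧ pt g 1 1 = 0) := by
  have h := (Matrix.mem_orthogonalGroup_iff (Fin 2) ℤ).1 g.1.right.2
  have key : ∀ i j, pt g i 0 * pt g j 0 + pt g i 1 * pt g j 1
      = (1 : Matrix (Fin 2) (Fin 2) ℤ) i j := by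
    intro i j
    have := congrFun (congrFun h i) j
    rw [Matrix.mul_apply, Fin.sum_univ_two] at this
    exact this
  have h00 := key 0 0
  have h01 := key 0 1
  have h11 := key 1 1
  simp only [Matrix.one_apply_eq, ne_eq, zero_ne_one, not_false_eq_true,
    Matrix.one_apply_ne] at h00 h01 h11
  generalize pt g 0 0 = a at *
  generalize pt g 0 1 = b at *
  generalize pt g 1 0 = c at *
  generalize pt g 1 1 = d at *
  have ha : -1 ≤ a ∧ a ≤ 1 := by constructor <;> nlinarith [sq_nonneg b]
  have hb : -1 ≤ b ∧ b ≤ 1 := by constructor <;> nlinarith [sq_nonneg a]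
  have hc : -1 ≤ c ∧ c ≤ 1 := by constructor <;> nlinarith [sq_nonneg d]
  have hd : -1 ≤ d ∧ d ≤ 1 := by constructor <;> nlinarith [sq_nonneg c]
  obtain ⟨ha1, ha2⟩ := ha
  obtain ⟨hb1, hb2⟩ := hb
  obtain ⟨hc1, hc2⟩ := hc
  obtain ⟨hd1, hd2⟩ := hd
  interval_cases a <;> interval_cases b <;> interval_cases c <;> interval_cases d <;> simp_all

theorem twist_coe (g : GPrime) :
    (twist g : ℤ) = pt g 0 0 * pt g 1 1 - pt g 0 1 * pt g 1 0 := by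
  have h : twist g = orientation g.1 := by
    change orientation g.1 * g.2 * g.2 = _
    rw [mul_assoc, Int.units_mul_self, mul_one]
  rw [h]
  exact Matrix.det_fin_two _

theorem coords_Tx_zpow (n : ℤ) : cx (Tx ^ n) = n ∧ cy (Tx ^ n) = 0 ∧
    (∀ i j, pt (Tx ^ n) i j = (1 : Matrix (Fin 2) (Fin 2) ℤ) i j) ∧ tau (Tx ^ n) = 1 := by
  have h : Tx ^ n = ((SemidirectProduct.inl (Multiplicative.ofAdd ![n, 0]), 1) : GPrime) := by
    rw [Tx, Prod.pow_mk, one_zpow, ← map_zpow, ← ofAdd_zsmul]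
    simp
  rw [h]
  exact ⟨rfl, rfl, fun _ _ => rfl, rfl⟩

theorem coords_Ty_zpow (n : ℤ) : cx (Ty ^ n) = 0 ∧ cy (Ty ^ n) = n ∧
    (∀ i j, pt (Ty ^ n) i j = (1 : Matrix (Fin 2) (Fin 2) ℤ) i j) ∧ tau (Ty ^ n) = 1 := by
  have h : Ty ^ n = ((SemidirectProduct.inl (Multiplicative.ofAdd ![0, n]), 1) : GPrime) := by
    rw [Ty, Prod.pow_mk, one_zpow, ← map_zpow, ← ofAdd_zsmul]
    simp
  rw [h]
  exact ⟨rfl, rfl, fun _ _ => rfl, rfl⟩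

theorem Pxy_Tx_Pxy : Pxy * Tx * Pxy = Ty := by
  apply GPrime.ext_coords <;> simp [Fin.forall_fin_two]

/-! ### The presentation of the symmetry group -/

section Presentation

variable {E : Type*} [Group E]

/-- The normal form `txᵐ tyⁿ pxⁱ pyʲ pxyᵏ trˡ` of a group element, evaluated on elements `tx`, `ty`,
`px`, `py`, `pxy`, `tr` of an arbitrary group. The exponents `i`, `j` record the signs of the two
rows of the point-group matrix, and `k` whether it exchanges the axes. -/
def normalForm (tx ty px py pxy tr : E) (g : GPrime) : E :=
  tx ^ cx g * ty ^ cy g * ((if pt g 0 0 + pt g 0 1 = 1 then 1 else px) *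
    ((if pt g 1 0 + pt g 1 1 = 1 then 1 else py) *
      ((if pt g 0 1 = 0 then 1 else pxy) * (if tau g = 1 then 1 else tr))))

theorem map_normalForm {F : Type*} [Group F] (f : E →* F) (tx ty px py pxy tr : E) (g : GPrime) :
    f (normalForm tx ty px py pxy tr g) =
      normalForm (f tx) (f ty) (f px) (f py) (f pxy) (f tr) g := by
  simp only [normalForm, map_mul, map_zpow, apply_ite f, map_one]

theorem normalForm_GPrime (g : GPrime) :
    normalForm Tx Ty Px (Pxy * Px * Pxy) Pxy Tr g = g := by
  obtain ⟨hx1, hx2, hx3, hx4⟩ := coords_Tx_zpow (cx g)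
  obtain ⟨hy1, hy2, hy3, hy4⟩ := coords_Ty_zpow (cy g)
  rcases pt_cases g with ⟨⟨h1 | h1, h2⟩, h3, h4 | h4⟩ | ⟨⟨h1, h2 | h2⟩, h3 | h3, h4⟩ <;>
    rcases tau_eq g with h5 | h5 <;>
    apply GPrime.ext_coords <;>
    simp [normalForm, h1, h2, h3, h4, h5, hx1, hx2, hx3, hx4, hy1, hy2, hy3, hy4,
      Fin.forall_fin_two]

/-- Sufficiency of the defining relations: if lifts of the generators along `π : E →* GPrime` obey
the relations exactly, then `π` has a homomorphic section. Left multiplication by each lift carries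
normal forms to normal forms, so the same holds for every product of lifts, in particular for the
normal forms themselves. -/
theorem exists_section_of_relations (π : E →* GPrime) {tx ty px pxy tr : E}
    (htx : π tx = Tx) (hpx : π px = Px) (hpxy : π pxy = Pxy) (htr : π tr = Tr)
    (hty : ty = pxy * tx * pxy)
    (r_txty : tx * ty * tx⁻¹ * ty⁻¹ = 1) (r_typx : ty * px * ty⁻¹ * px = 1) (r_px : px ^ 2 = 1)
    (r_txpx : tx * px * tx * px = 1) (r_pxy : pxy ^ 2 = 1) (r_pxpxy : (px * pxy) ^ 4 = 1)
    (r_T : tr ^ 2 = 1) (r_Ttx : tr * tx = tx * tr) (r_Tpx : tr * px = px * tr)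
    (r_Tpxy : tr * pxy = pxy * tr) :
    ∃ s : GPrime →* E, ∀ g, π (s g) = g := by
  have px2 : px * px = 1 := by rw [← sq, r_px]
  have pxy2 : pxy * pxy = 1 := by rw [← sq, r_pxy]
  have tr2 : tr * tr = 1 := by rw [← sq, r_T]
  have ipx : px⁻¹ = px := inv_eq_of_mul_eq_one_right px2
  have ipxy : pxy⁻¹ = pxy := inv_eq_of_mul_eq_one_right pxy2
  obtain ⟨py, hpy⟩ : ∃ py, py = pxy * px * pxy := ⟨_, rfl⟩
  have py2 : py * py = 1 := by
    rw [hpy, show pxy * px * pxy * (pxy * px * pxy) = pxy * (px * ((pxy * pxy) * px)) * pxy by group,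
      pxy2, one_mul, px2, mul_one, pxy2]
  have πty : π ty = Ty := by rw [hty]; simp [htx, hpxy, Pxy_Tx_Pxy]
  have πpy : π py = Pxy * Px * Pxy := by rw [hpy]; simp [hpx, hpxy]
  -- commutation rules for the lifts
  have c_txty : Commute tx ty := by
    rw [mul_inv_eq_one, mul_inv_eq_iff_eq_mul] at r_txty
    exact r_txty
  have c_pxty : SemiconjBy px ty ty := by
    have h := eq_inv_of_mul_eq_one_left r_typx
    rw [ipx, mul_inv_eq_iff_eq_mul] at h
    exact h.symm
  have c_pxtx : SemiconjBy px tx tx⁻¹ := by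
    have h := eq_inv_of_mul_eq_one_left r_txpx
    rw [ipx, mul_assoc, ← eq_inv_mul_iff_mul_eq] at h
    exact h
  have c_pxytx : SemiconjBy pxy tx ty := by
    change pxy * tx = ty * pxy
    rw [hty, mul_assoc (pxy * tx), pxy2, mul_one]
  have c_pxyty : SemiconjBy pxy ty tx := by
    change pxy * ty = tx * pxy
    rw [hty, ← mul_assoc, ← mul_assoc, pxy2, one_mul]
  have c_pxypx : pxy * px = py * pxy := by
    rw [hpy, mul_assoc (pxy * px), pxy2, mul_one]
  have c_pxypy : pxy * py = px * pxy := by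
    rw [hpy, ← mul_assoc, ← mul_assoc, pxy2, one_mul]
  have c_pypx : py * px = px * py := by
    have h : (px * py) * (px * py) = 1 := by
      rw [← r_pxpxy, hpy]
      simp only [pow_succ, pow_zero, one_mul, mul_assoc]
    have h' := eq_inv_of_mul_eq_one_left h
    rw [mul_inv_rev, ipx, inv_eq_of_mul_eq_one_right py2] at h'
    exact h'.symm
  have c_Tty : Commute tr ty := by
    rw [hty]
    exact (Commute.mul_right (Commute.mul_right r_Tpxy r_Ttx) r_Tpxy)
  have c_Tpy : Commute tr py := by
    rw [hpy]
    exact (Commute.mul_right (Commute.mul_right r_Tpxy r_Tpx) r_Tpxy)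
  set s := normalForm tx ty px py pxy tr with hs
  have hπs : ∀ g, π (s g) = g := by
    intro g
    rw [hs, map_normalForm, htx, πty, hpx, πpy, hpxy, htr, normalForm_GPrime]
  -- the elements whose left multiplication preserves normal forms
  let K : Subgroup E :=
    { carrier := {X | ∀ g, X * s g = s (π X * g)}
      one_mem' := by
        intro g
        simp
      mul_mem' := by
        intro X Y hX hY g
        rw [mul_assoc, hY, hX, map_mul, mul_assoc]
      inv_mem' := by
        intro X hX g
        rw [inv_mul_eq_iff_eq_mul, hX, map_inv, mul_inv_cancel_left] }
  have Ktx : tx ∈ K := by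
    intro g
    rw [htx]
    simp [hs, normalForm, zpow_add, mul_assoc]
  have Kpx : px ∈ K := by
    intro g
    have e1 : px * (tx ^ cx g * ty ^ cy g) = tx ^ (-cx g) * ty ^ cy g * px := by
      rw [← mul_assoc, (c_pxtx.zpow_right _).eq, mul_assoc, (c_pxty.zpow_right _).eq, inv_zpow',
        mul_assoc]
    rw [hpx, hs, normalForm, ← mul_assoc px, e1]
    rcases pt_cases g with ⟨⟨h1 | h1, h2⟩, h3, h4 | h4⟩ | ⟨⟨h1, h2 | h2⟩, h3 | h3, h4⟩ <;>
      simp [normalForm, h1, h2, h3, h4, mul_assoc, ← mul_assoc px px, px2]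
  have Kpxy : pxy ∈ K := by
    intro g
    have e1 : pxy * (tx ^ cx g * ty ^ cy g) = tx ^ cy g * ty ^ cx g * pxy := by
      rw [← mul_assoc, (c_pxytx.zpow_right _).eq, mul_assoc, (c_pxyty.zpow_right _).eq,
        ← mul_assoc, (c_txty.zpow_zpow _ _).eq]
    rw [hpxy, hs, normalForm, ← mul_assoc pxy, e1]
    rcases pt_cases g with ⟨⟨h1 | h1, h2⟩, h3, h4 | h4⟩ | ⟨⟨h1, h2 | h2⟩, h3 | h3, h4⟩ <;>
      simp [normalForm, h1, h2, h3, h4, mul_assoc, ← mul_assoc pxy px, ← mul_assoc pxy py,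
        ← mul_assoc pxy pxy, c_pxypx, c_pxypy, pxy2, ← mul_assoc py px, c_pypx]
  have Ktr : tr ∈ K := by
    intro g
    have e1 : Commute tr (tx ^ cx g * ty ^ cy g) :=
      (Commute.zpow_right r_Ttx _).mul_right (c_Tty.zpow_right _)
    have e2 : Commute tr (if pt g 0 0 + pt g 0 1 = 1 then 1 else px) := by
      split_ifs
      exacts [Commute.one_right _, r_Tpx]
    have e3 : Commute tr (if pt g 1 0 + pt g 1 1 = 1 then 1 else py) := by
      split_ifs
      exacts [Commute.one_right _, c_Tpy]
    have e4 : Commute tr (if pt g 0 1 = 0 then 1 else pxy) := by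
      split_ifs
      exacts [Commute.one_right _, r_Tpxy]
    have e5 : tr * (if tau g = 1 then 1 else tr) = if tau (Tr * g) = 1 then 1 else tr := by
      rcases tau_eq g with h | h <;> simp [h, tr2]
    rw [htr, hs, normalForm, ← mul_assoc tr, e1.eq, mul_assoc (tx ^ cx g * ty ^ cy g),
      ← mul_assoc tr, e2.eq, mul_assoc _ tr, ← mul_assoc tr, e3.eq, mul_assoc _ tr,
      ← mul_assoc tr, e4.eq, mul_assoc _ tr, e5]
    simp [normalForm]
  have Kty : ty ∈ K := by
    rw [hty]
    exact K.mul_mem (K.mul_mem Kpxy Ktx) Kpxy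
  have Kpy : py ∈ K := by
    rw [hpy]
    exact K.mul_mem (K.mul_mem Kpxy Kpx) Kpxy
  have Ks : ∀ g, s g ∈ K := by
    intro g
    have hite : ∀ (p : Prop) [Decidable p] (X : E), X ∈ K → (if p then 1 else X) ∈ K := by
      intro p _ X hX
      split_ifs
      exacts [K.one_mem, hX]
    exact K.mul_mem (K.mul_mem (K.zpow_mem Ktx _) (K.zpow_mem Kty _))
      (K.mul_mem (hite _ _ Kpx) (K.mul_mem (hite _ _ Kpy)
        (K.mul_mem (hite _ _ Kpxy) (hite _ _ Ktr))))
  exact ⟨MonoidHom.mk' s fun g h => by rw [Ks g h, hπs], hπs⟩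

end Presentation

/-! ### The phases of arbitrary lifts -/

theorem Tx_mul_Ty : Tx * Ty = Ty * Tx := by
  apply GPrime.ext_coords <;> simp

theorem Ty_mul_Px : Ty * Px = Px * Ty := by
  apply GPrime.ext_coords <;> simp [Fin.forall_fin_two]

theorem Px_mul_Px : Px * Px = 1 := by
  apply GPrime.ext_coords <;> simp [Fin.forall_fin_two]

theorem Pxy_mul_Pxy : Pxy * Pxy = 1 := by
  apply GPrime.ext_coords <;> simp [Fin.forall_fin_two]

theorem Tr_mul_Tr : Tr * Tr = 1 := by
  apply GPrime.ext_coords <;> simp [Fin.forall_fin_two]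

theorem TxPx_mul_TxPx : Tx * Px * (Tx * Px) = 1 := by
  apply GPrime.ext_coords <;> simp [Fin.forall_fin_two]

theorem PxPxy_pow_four : Px * Pxy * (Px * Pxy) * (Px * Pxy * (Px * Pxy)) = 1 := by
  apply GPrime.ext_coords <;> simp [Fin.forall_fin_two]

theorem pow_four_eq_mul {E : Type*} [Group E] (x : E) : x ^ 4 = x * x * (x * x) := by
  rw [← sq, ← sq, ← pow_mul]

theorem Tr_comm (g : P4mm) : Tr * (g, 1) = (g, 1) * Tr := by
  simp [Tr]

namespace Extension

variable {G : Type*} [Group G] {t : G →* ℤˣ} {M : Type*} [CommGroup M] {ω : cocycles₂ t M}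

theorem incl_mul (m : M) (x : Extension ω) : incl ω m * x = ⟨m * x.coeff, x.elt⟩ := by
  ext
  · simp [mul_def, incl, cocycle_one_left]
    rw [mul_right_comm, inv_mul_cancel_right]
  · simp [mul_def, incl]

theorem incl_injective : Function.Injective (incl ω) := by
  intro m n h
  exact mul_right_cancel (congrArg coeff h)

theorem eq_incl_iff {x : Extension ω} (hx : x.elt = 1) (m : M) :
    x = incl ω m ↔ x.coeff * ω.1 (1, 1) = m := by
  rw [Extension.ext_iff, ← eq_mul_inv_iff_mul_eq]
  exact and_iff_left hx

end Extension

/-- The values of the twist on the generators that the phase computation uses: translations and time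
reversal act trivially, and both reflections act by the same sign. -/
structure IsReflectionTwist (t : GPrime →* ℤˣ) : Prop where
  Tx : t Tx = 1
  Tr : t Tr = 1
  Pxy : t Pxy = t Px

theorem isReflectionTwist_one : IsReflectionTwist 1 := ⟨rfl, rfl, rfl⟩

theorem twist_Px : twist Px = -1 := by
  apply Units.ext
  rw [twist_coe]
  simp

theorem isReflectionTwist_twist : IsReflectionTwist twist := by
  constructor <;> apply Units.ext <;> simp [twist_coe]

section Phases

variable {t : GPrime →* ℤˣ} {M : Type*} [CommGroup M]

/-- The coefficient of the lift `pxy * tx * pxy` of `Ty`, for lifts `tx = (a, Tx)`,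
`pxy = (b, Pxy)`. -/
def tyCoeff (ω : cocycles₂ t M) (a b : M) : M :=
  b * a ^ (t Px : ℤ) * ω.1 (Pxy, Tx) * b ^ (t Px : ℤ) * ω.1 (Pxy * Tx, Pxy)

/-- The phases in the defining relations for the lifts `tx = (a, Tx)`, `pxy = (b, Pxy)`,
`px = (c, Px)`, `tr = (d, Tr)`, as monomials in `a`, `b`, `c`, `d` and the values of the factor
set. -/
def phases (ω : cocycles₂ t M) (a b c d : M) : RelIndex → M
  | .txty => ω.1 (Tx, Ty) / ω.1 (Ty, Tx)
  | .typx => tyCoeff ω a b / tyCoeff ω a b ^ (t Px : ℤ) * (ω.1 (Ty, Px) / ω.1 (Px, Ty)) *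
      (c * c ^ (t Px : ℤ) * ω.1 (Px, Px) * ω.1 (1, 1))
  | .px => c * c ^ (t Px : ℤ) * ω.1 (Px, Px) * ω.1 (1, 1)
  | .txpx => a * c * ω.1 (Tx, Px) * (a * c * ω.1 (Tx, Px)) ^ (t Px : ℤ) *
      ω.1 (Tx * Px, Tx * Px) * ω.1 (1, 1)
  | .pxy => b * b ^ (t Px : ℤ) * ω.1 (Pxy, Pxy) * ω.1 (1, 1)
  | .pxpxy => (c * b ^ (t Px : ℤ) * ω.1 (Px, Pxy)) ^ 4 * ω.1 (Px * Pxy, Px * Pxy) ^ 2 *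
      ω.1 (Px * Pxy * (Px * Pxy), Px * Pxy * (Px * Pxy)) * ω.1 (1, 1)
  | .T => d ^ 2 * ω.1 (Tr, Tr) * ω.1 (1, 1)
  | .Ttx => ω.1 (Tr, Tx) / ω.1 (Tx, Tr)
  | .Tpx => d / d ^ (t Px : ℤ) * (ω.1 (Tr, Px) / ω.1 (Px, Tr))
  | .Tpxy => d / d ^ (t Px : ℤ) * (ω.1 (Tr, Pxy) / ω.1 (Pxy, Tr))

/-- The lifts of the generators with prescribed coefficients. -/
def mkLifts (ω : cocycles₂ t M) (a b c d : M) : GeneratorLifts ω where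
  tx := ⟨a, Tx⟩
  ty := ⟨b, Pxy⟩ * ⟨a, Tx⟩ * ⟨b, Pxy⟩
  px := ⟨c, Px⟩
  pxy := ⟨b, Pxy⟩
  tr := ⟨d, Tr⟩
  proj_tx := rfl
  proj_ty := by
    rw [map_mul, map_mul]
    exact Pxy_Tx_Pxy
  proj_px := rfl
  proj_pxy := rfl
  proj_tr := rfl
  ty_eq := rfl

theorem GeneratorLifts.exists_eq_mkLifts {ω : cocycles₂ t M} (L : GeneratorLifts ω) :
    ∃ a b c d, L = mkLifts ω a b c d := by
  obtain ⟨⟨a, _⟩, _, ⟨c, _⟩, ⟨b, _⟩, ⟨d, _⟩, h1, _, h3, h4, h5, h6⟩ := L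
  cases h1
  cases h3
  cases h4
  cases h5
  cases h6
  exact ⟨a, b, c, d, rfl⟩

theorem GeneratorLifts.Realizes.unique {ω : cocycles₂ t M} {L : GeneratorLifts ω}
    {α β : RelIndex → M} (hα : L.Realizes α) (hβ : L.Realizes β) : α = β := by
  obtain ⟨h1, h2, h3, h4, h5, h6, h7, h8, h9, h10⟩ := hα
  obtain ⟨k1, k2, k3, k4, k5, k6, k7, k8, k9, k10⟩ := hβ
  funext i
  apply Extension.incl_injective (ω := ω)
  cases i
  · exact h1.symm.trans k1
  · exact h2.symm.trans k2
  · exact h3.symm.trans k3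
  · exact h4.symm.trans k4
  · exact h5.symm.trans k5
  · exact h6.symm.trans k6
  · exact h7.symm.trans k7
  · exact mul_right_cancel (mul_right_cancel (h8.symm.trans k8))
  · exact mul_right_cancel (mul_right_cancel (h9.symm.trans k9))
  · exact mul_right_cancel (mul_right_cancel (h10.symm.trans k10))

theorem mkLifts_ty (ht : IsReflectionTwist t) (ω : cocycles₂ t M) (a b c d : M) :
    (mkLifts ω a b c d).ty = ⟨tyCoeff ω a b, Ty⟩ := by
  ext1
  · simp [mkLifts, Extension.mul_def, tyCoeff, ht.Pxy, ht.Tx]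
  · exact Pxy_Tx_Pxy

theorem mkLifts_realizes (ht : IsReflectionTwist t) (ω : cocycles₂ t M) (a b c d : M) :
    (mkLifts ω a b c d).Realizes (phases ω a b c d) := by
  have tTy : t Ty = 1 := by
    rw [← Pxy_Tx_Pxy]
    simp [ht.Pxy, ht.Tx]
  have tPxPxy : t (Px * Pxy) = 1 := by simp [ht.Pxy]
  have hpx : (⟨c, Px⟩ : Extension ω) ^ 2 = Extension.incl ω (phases ω a b c d .px) := by
    rw [sq, Extension.eq_incl_iff Px_mul_Px]
    rfl
  rw [GeneratorLifts.Realizes, mkLifts_ty ht]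
  dsimp only [mkLifts]
  refine ⟨?_, ?_, hpx, ?_, ?_, ?_, ?_, ?_, ?_, ?_⟩
  · rw [mul_inv_eq_iff_eq_mul, mul_inv_eq_iff_eq_mul, mul_assoc, Extension.incl_mul]
    ext1
    · simp [Extension.mul_def, phases, ht.Tx, tTy]
      apply Additive.ofMul.injective
      simp only [ofMul_mul]
      module
    · exact Tx_mul_Ty
  · have h : (⟨tyCoeff ω a b, Ty⟩ * ⟨c, Px⟩ : Extension ω) =
        Extension.incl ω (phases ω a b c d .typx / phases ω a b c d .px) *
          (⟨c, Px⟩ * ⟨tyCoeff ω a b, Ty⟩) := by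
      rw [Extension.incl_mul]
      ext1
      · simp [Extension.mul_def, phases, tTy]
        apply Additive.ofMul.injective
        simp only [ofMul_mul, ofMul_div, ofMul_zpow]
        module
      · exact Ty_mul_Px
    rw [h, div_eq_mul_inv, map_mul, map_inv, ← hpx]
    group
  · rw [mul_assoc, Extension.eq_incl_iff TxPx_mul_TxPx]
    simp [Extension.mul_def, phases, ht.Tx]
  · rw [sq, Extension.eq_incl_iff Pxy_mul_Pxy]
    simp [Extension.mul_def, phases, ht.Pxy]
  · rw [pow_four_eq_mul, Extension.eq_incl_iff PxPxy_pow_four]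
    simp only [Extension.mul_def, phases, map_mul t _ (_ * _), tPxPxy]
    simp [pow_succ]
    ac_rfl
  · rw [sq, Extension.eq_incl_iff Tr_mul_Tr]
    simp [Extension.mul_def, phases, ht.Tr, sq]
  · rw [mul_assoc, Extension.incl_mul]
    ext1
    · simp [Extension.mul_def, phases, ht.Tx, ht.Tr]
      apply Additive.ofMul.injective
      simp only [ofMul_mul]
      module
    · exact Tr_comm _
  · rw [mul_assoc, Extension.incl_mul]
    ext1
    · simp [Extension.mul_def, phases, ht.Tr]
      apply Additive.ofMul.injective
      simp only [ofMul_mul, ofMul_div, ofMul_zpow]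
      module
    · exact Tr_comm _
  · rw [mul_assoc, Extension.incl_mul]
    ext1
    · simp [Extension.mul_def, phases, ht.Tr, ht.Pxy]
      apply Additive.ofMul.injective
      simp only [ofMul_mul, ofMul_div, ofMul_zpow]
      module
    · exact Tr_comm _

theorem phases_mul (ω₁ ω₂ : cocycles₂ t M) (a₁ b₁ c₁ d₁ a₂ b₂ c₂ d₂ : M) :
    phases (ω₁ * ω₂) (a₁ * a₂) (b₁ * b₂) (c₁ * c₂) (d₁ * d₂) =
      phases ω₁ a₁ b₁ c₁ d₁ * phases ω₂ a₂ b₂ c₂ d₂ := by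
  funext i
  apply Additive.ofMul.injective
  cases i <;>
    simp only [phases, tyCoeff, Pi.mul_apply, Subgroup.coe_mul, ofMul_mul, ofMul_div, ofMul_zpow,
      ofMul_pow] <;>
    module

/-! ### Trivial phases characterize coboundaries -/

theorem mem_coboundaries₂_iff_phases (ht : IsReflectionTwist t) (ω : cocycles₂ t M) :
    ω ∈ coboundaries₂ t M ↔ ∃ a b c d, phases ω a b c d = 1 := by
  constructor
  · rintro ⟨l, hl⟩
    have hω : ∀ g h, ω.1 (g, h) = l g * l h ^ (t g : ℤ) * (l (g * h))⁻¹ := fun g h =>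
      (congrFun hl (g, h)).symm
    -- a trivializing cochain `l` splits the extension by `g ↦ (l(g)⁻¹, g)`
    let s : GPrime →* Extension ω := MonoidHom.mk' (fun g => ⟨(l g)⁻¹, g⟩) fun g h => by
      ext1
      · simp [Extension.mul_def, hω]
        apply Additive.ofMul.injective
        simp only [ofMul_mul, ofMul_inv, ofMul_zpow]
        module
      · rfl
    refine ⟨(l Tx)⁻¹, (l Pxy)⁻¹, (l Px)⁻¹, (l Tr)⁻¹,
      (mkLifts_realizes ht ω _ _ _ _).unique ?_⟩
    rw [GeneratorLifts.Realizes]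
    change s Tx * (s Pxy * s Tx * s Pxy) * (s Tx)⁻¹ * (s Pxy * s Tx * s Pxy)⁻¹ = _ ∧
      s Pxy * s Tx * s Pxy * s Px * (s Pxy * s Tx * s Pxy)⁻¹ * s Px = _ ∧
      s Px ^ 2 = _ ∧ s Tx * s Px * s Tx * s Px = _ ∧ s Pxy ^ 2 = _ ∧ (s Px * s Pxy) ^ 4 = _ ∧
      s Tr ^ 2 = _ ∧ s Tr * s Tx = _ * s Tx * s Tr ∧ s Tr * s Px = _ * s Px * s Tr ∧
      s Tr * s Pxy = _ * s Pxy * s Tr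
    simp only [Pi.one_apply, map_one, one_mul, ← map_mul, ← map_inv, ← map_pow, Pxy_Tx_Pxy]
    refine ⟨?_, ?_, ?_, ?_, ?_, ?_, ?_, ?_, ?_, ?_⟩
    · rw [Tx_mul_Ty]
      simp
    · rw [Ty_mul_Px, mul_inv_cancel_right, Px_mul_Px, map_one]
    · rw [sq, Px_mul_Px, map_one]
    · rw [mul_assoc, TxPx_mul_TxPx, map_one]
    · rw [sq, Pxy_mul_Pxy, map_one]
    · rw [pow_four_eq_mul, PxPxy_pow_four, map_one]
    · rw [sq, Tr_mul_Tr, map_one]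
    · rw [show Tr * Tx = Tx * Tr from Tr_comm _]
    · rw [show Tr * Px = Px * Tr from Tr_comm _]
    · rw [show Tr * Pxy = Pxy * Tr from Tr_comm _]
  · rintro ⟨a, b, c, d, h⟩
    have hL := mkLifts_realizes ht ω a b c d
    set L := mkLifts ω a b c d
    rw [h] at hL
    simp only [GeneratorLifts.Realizes, Pi.one_apply, map_one, one_mul] at hL
    obtain ⟨h1, h2, h3, h4, h5, h6, h7, h8, h9, h10⟩ := hL
    obtain ⟨s, hs⟩ := exists_section_of_relations (Extension.proj ω) L.proj_tx L.proj_px L.proj_pxy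
      L.proj_tr L.ty_eq h1 h2 h3 h4 h5 h6 h7 h8 h9 h10
    refine ⟨fun g => (s g).coeff⁻¹, ?_⟩
    funext ⟨g, h⟩
    have hm := congrArg Extension.coeff (map_mul s g h)
    have hg : (s g).elt = g := hs g
    have hh : (s h).elt = h := hs h
    simp only [Extension.mul_def, hg, hh] at hm
    simp only [coboundary₁, MonoidHom.coe_mk, OneHom.coe_mk, hm]
    change _ = ω.1 (g, h)
    apply Additive.ofMul.injective
    simp only [ofMul_mul, ofMul_inv, ofMul_zpow]
    module

end Phases

/-! ### Factor sets with integer exponents -/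

/-- `e` is an integer-valued `t`-twisted factor set modulo `N`; for `N = 0` it is a factor set over
`ℤ`. -/
def IsIntCocycle (t : GPrime →* ℤˣ) (N : ℤ) (e : GPrime → GPrime → ℤ) : Prop :=
  ∀ g h k, e g h + e (g * h) k ≡ e g (h * k) + e h k * t g [ZMOD N]

theorem IsIntCocycle.sign {t : GPrime →* ℤˣ} {e : GPrime → GPrime → ℤ} (he : IsIntCocycle t 0 e) :
    IsIntCocycle 1 2 e := by
  intro g h k
  rw [Int.modEq_zero_iff.1 (he g h k)]
  refine Int.ModEq.add_left _ (Int.ModEq.mul_left _ ?_)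
  rcases Int.units_eq_one_or (t g) with h | h <;> rw [h]
  · rfl
  · exact (by decide : (-1 : ℤ) ≡ 1 [ZMOD 2])

section zpowCocycle

variable {t : GPrime →* ℤˣ} {M : Type*} [CommGroup M] {N : ℤ}

/-- The factor set `z ^ e(g, h)`. -/
def zpowCocycle (z : M) (hz : z ^ N = 1) (e : GPrime → GPrime → ℤ) (he : IsIntCocycle t N e) :
    cocycles₂ t M :=
  ⟨fun p => z ^ e p.1 p.2, fun g h k => by
    obtain ⟨m, hm⟩ := (he g h k).dvd
    rw [← zpow_mul, ← zpow_add, ← zpow_add, eq_comm, ← mul_inv_eq_one, ← zpow_neg, ← zpow_add,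
      ← sub_eq_add_neg, hm, zpow_mul, hz, one_zpow]⟩

/-- The exponents of the phases of the factor set `z ^ e(g, h)` for the lifts with trivial
coefficients, where `ε` is the value of the twist on the reflections. -/
def intPhases (ε : ℤ) (e : GPrime → GPrime → ℤ) : RelIndex → ℤ
  | .txty => e Tx Ty - e Ty Tx
  | .typx => (e Pxy Tx + e (Pxy * Tx) Pxy) * (1 - ε) + (e Ty Px - e Px Ty) + (e Px Px + e 1 1)
  | .px => e Px Px + e 1 1
  | .txpx => e Tx Px * (1 + ε) + e (Tx * Px) (Tx * Px) + e 1 1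
  | .pxy => e Pxy Pxy + e 1 1
  | .pxpxy => e Px Pxy * 4 + e (Px * Pxy) (Px * Pxy) * 2 +
      e (Px * Pxy * (Px * Pxy)) (Px * Pxy * (Px * Pxy)) + e 1 1
  | .T => e Tr Tr + e 1 1
  | .Ttx => e Tr Tx - e Tx Tr
  | .Tpx => e Tr Px - e Px Tr
  | .Tpxy => e Tr Pxy - e Pxy Tr

theorem phases_zpowCocycle (z : M) (hz : z ^ N = 1) (e : GPrime → GPrime → ℤ)
    (he : IsIntCocycle t N e) (i : RelIndex) :
    phases (zpowCocycle z hz e he) 1 1 1 1 i = z ^ intPhases (t Px) e i := by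
  apply Additive.ofMul.injective
  cases i <;>
    simp only [phases, tyCoeff, intPhases, zpowCocycle, ofMul_mul, ofMul_div, ofMul_zpow, ofMul_pow,
      ofMul_one] <;>
    module

end zpowCocycle

/-- The Landau-gauge area exponent `x_g (A_g v_h)_y`, where `g` has translation part
`v_g = (x_g, y_g)` and point-group part `A_g`, corrected by a multiple of `x_h y_h` when `A_g`
exchanges the axes. -/
def areaExp (g h : GPrime) : ℤ :=
  cx g * (pt g 1 0 * cx h + pt g 1 1 * cy h) + pt g 0 1 * pt g 1 0 * (cx h * cy h)

theorem isIntCocycle_areaExp : IsIntCocycle twist 0 areaExp := by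
  intro g h k
  rw [Int.modEq_zero_iff, twist_coe]
  simp only [areaExp, cx_mul, cy_mul, pt_mul]
  rcases pt_cases g with ⟨⟨h1 | h1, h2⟩, h3, h4 | h4⟩ | ⟨⟨h1, h2 | h2⟩, h3 | h3, h4⟩ <;>
    rw [h1, h2, h3, h4] <;>
    rcases pt_cases h with ⟨⟨k1 | k1, k2⟩, k3, k4 | k4⟩ | ⟨⟨k1, k2 | k2⟩, k3 | k3, k4⟩ <;>
    rw [k1, k2, k3, k4] <;>
    ring

/-- The twisted coboundary of an integer cochain. -/
def intCoboundary (l : GPrime → ℤ) (g h : GPrime) : ℤ :=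
  l g + twist g * l h - l (g * h)

/-- Dividing a coboundary by a common factor of its values gives a factor set (the Bockstein
construction). -/
theorem isIntCocycle_intCoboundary_div {l : GPrime → ℤ} {n : ℤ} (hn : n ≠ 0)
    (hl : ∀ g h, n ∣ intCoboundary l g h) :
    IsIntCocycle twist 0 fun g h => intCoboundary l g h / n := by
  intro g h k
  rw [Int.modEq_zero_iff]
  apply mul_left_cancel₀ hn
  dsimp only
  rw [mul_add, mul_add, ← mul_assoc, Int.mul_ediv_cancel' (hl _ _), Int.mul_ediv_cancel' (hl _ _),
    Int.mul_ediv_cancel' (hl _ _), Int.mul_ediv_cancel' (hl _ _)]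
  simp only [intCoboundary, map_mul, Units.val_mul, mul_assoc]
  ring

/-- The sum of the coordinates of the translation part. Modulo 2 it is a character. -/
def parity (g : GPrime) : ℤ := cx g + cy g

/-- The direction of the image of the first basis vector in units of a right angle, as one of the
integers `0, 1, 2, 3`. Modulo 4 it is a twisted character, since reflections reverse angles. -/
def angle (g : GPrime) : ℤ :=
  pt g 0 0 * (pt g 0 0 - 1) + pt g 1 0 * (2 * pt g 1 0 - 1)

theorem two_dvd_intCoboundary_parity (g h : GPrime) : 2 ∣ intCoboundary parity g h := by
  simp only [intCoboundary, parity, twist_coe, cx_mul, cy_mul]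
  rcases pt_cases g with ⟨⟨h1 | h1, h2⟩, h3, h4 | h4⟩ | ⟨⟨h1, h2 | h2⟩, h3 | h3, h4⟩ <;>
    rw [h1, h2, h3, h4] <;> omega

theorem four_dvd_intCoboundary_tau (g h : GPrime) :
    4 ∣ intCoboundary (fun g => 1 - tau g) g h := by
  simp only [intCoboundary, twist_coe, tau_mul]
  rcases pt_cases g with ⟨⟨h1 | h1, h2⟩, h3, h4 | h4⟩ | ⟨⟨h1, h2 | h2⟩, h3 | h3, h4⟩ <;>
    rw [h1, h2, h3, h4] <;>
    rcases tau_eq g with h5 | h5 <;> rcases tau_eq h with h6 | h6 <;> rw [h5, h6] <;> decide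

theorem four_dvd_intCoboundary_angle (g h : GPrime) : 4 ∣ intCoboundary angle g h := by
  simp only [intCoboundary, twist_coe, angle, pt_mul]
  rcases pt_cases g with ⟨⟨h1 | h1, h2⟩, h3, h4 | h4⟩ | ⟨⟨h1, h2 | h2⟩, h3 | h3, h4⟩ <;>
    rw [h1, h2, h3, h4] <;>
    rcases pt_cases h with ⟨⟨k1 | k1, k2⟩, k3, k4 | k4⟩ | ⟨⟨k1, k2 | k2⟩, k3 | k3, k4⟩ <;>
    rw [k1, k3] <;> decide

/-- Half the coboundary of the translation parity. -/
def parityExp (g h : GPrime) : ℤ := intCoboundary parity g h / 2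
/-- A quarter of the coboundary of `1 - tau`. -/
def timeExp (g h : GPrime) : ℤ := intCoboundary (fun g => 1 - tau g) g h / 4
/-- A quarter of the coboundary of the rotation angle. -/
def angleExp (g h : GPrime) : ℤ := intCoboundary angle g h / 4

theorem isIntCocycle_parityExp : IsIntCocycle twist 0 parityExp :=
  isIntCocycle_intCoboundary_div two_ne_zero two_dvd_intCoboundary_parity
theorem isIntCocycle_timeExp : IsIntCocycle twist 0 timeExp :=
  isIntCocycle_intCoboundary_div four_ne_zero four_dvd_intCoboundary_tau
theorem isIntCocycle_angleExp : IsIntCocycle twist 0 angleExp :=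
  isIntCocycle_intCoboundary_div four_ne_zero four_dvd_intCoboundary_angle

/-- An additive character modulo 2, given by integer representatives. -/
def IsBit (a : GPrime → ℤ) : Prop := ∀ g h, a (g * h) ≡ a g + a h [ZMOD 2]

/-- The cup product of two characters modulo 2. -/
theorem IsBit.isIntCocycle_cup {a b : GPrime → ℤ} (ha : IsBit a) (hb : IsBit b) :
    IsIntCocycle 1 2 fun g h => a g * b h := by
  intro g h k
  have h1 := (ha g h).mul_right (b k)
  have h2 := (hb h k).mul_left (a g)
  calc a g * b h + a (g * h) * b k ≡ a g * b h + (a g + a h) * b k [ZMOD 2] := h1.add_left _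
    _ = a g * (b h + b k) + a h * b k * ((1 : GPrime →* ℤˣ) g : ℤˣ) := by
      simp
      ring
    _ ≡ _ [ZMOD 2] := h2.symm.add_right _

/-- The number of negative entries of the point-group part; the sum of the entries is `2`, `0` or
`-2`, so the division is exact. -/
def minusCount (g : GPrime) : ℤ := (2 - (pt g 0 0 + pt g 0 1 + pt g 1 0 + pt g 1 1)) / 2
/-- The bit of time reversal, `0` or `1`. -/
def timeBit (g : GPrime) : ℤ := (1 - tau g) / 2
/-- An integer that is odd when the point-group part exchanges the axes. -/
def swapBit (g : GPrime) : ℤ := pt g 0 1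

theorem isBit_parity : IsBit parity := by
  intro g h
  simp only [parity, cx_mul, cy_mul]
  rw [Int.modEq_iff_dvd]
  rcases pt_cases g with ⟨⟨h1 | h1, h2⟩, h3, h4 | h4⟩ | ⟨⟨h1, h2 | h2⟩, h3 | h3, h4⟩ <;>
    rw [h1, h2, h3, h4] <;> omega

theorem isBit_minusCount : IsBit minusCount := by
  intro g h
  simp only [minusCount, pt_mul]
  rcases pt_cases g with ⟨⟨h1 | h1, h2⟩, h3, h4 | h4⟩ | ⟨⟨h1, h2 | h2⟩, h3 | h3, h4⟩ <;>
    rw [h1, h2, h3, h4] <;>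
    rcases pt_cases h with ⟨⟨k1 | k1, k2⟩, k3, k4 | k4⟩ | ⟨⟨k1, k2 | k2⟩, k3 | k3, k4⟩ <;>
    rw [k1, k2, k3, k4] <;> decide

theorem isBit_swapBit : IsBit swapBit := by
  intro g h
  simp only [swapBit, pt_mul]
  rcases pt_cases g with ⟨⟨h1 | h1, h2⟩, h3, h4 | h4⟩ | ⟨⟨h1, h2 | h2⟩, h3 | h3, h4⟩ <;>
    rw [h1, h2] <;>
    rcases pt_cases h with ⟨⟨k1 | k1, k2⟩, k3, k4 | k4⟩ | ⟨⟨k1, k2 | k2⟩, k3 | k3, k4⟩ <;>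
    rw [k2, k4] <;> decide

theorem isBit_timeBit : IsBit timeBit := by
  intro g h
  simp only [timeBit, tau_mul]
  rcases tau_eq g with h5 | h5 <;> rcases tau_eq h with h6 | h6 <;> rw [h5, h6] <;> decide

theorem intPhases_areaExp (ε : ℤ) (i : RelIndex) :
    intPhases ε areaExp i = if i = .txty then 1 else 0 := by
  cases i <;> simp [intPhases, areaExp]

theorem intPhases_parityExp (i : RelIndex) :
    intPhases 1 parityExp i = if i = .typx then 1 else 0 := by
  cases i <;> rfl

theorem intPhases_angleExp (i : RelIndex) :
    intPhases 1 angleExp i = if i = .pxpxy then 1 else 0 := by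
  cases i <;> rfl

theorem intPhases_timeExp (i : RelIndex) :
    intPhases 1 timeExp i = if i = .T ∨ i = .Tpx ∨ i = .Tpxy then 1 else 0 := by
  cases i <;> rfl

theorem intPhases_minusCount_minusCount (i : RelIndex) :
    intPhases 1 (fun g h => minusCount g * minusCount h) i =
      if i = .px ∨ i = .typx ∨ i = .txpx then 1 else if i = .pxpxy then 6 else 0 := by
  cases i <;> rfl

theorem intPhases_parity_parity (i : RelIndex) :
    intPhases 1 (fun g h => parity g * parity h) i = if i = .txpx then 1 else 0 := by
  cases i <;> rfl

theorem intPhases_swapBit_swapBit (i : RelIndex) :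
    intPhases 1 (fun g h => swapBit g * swapBit h) i =
      if i = .pxy then 1 else if i = .pxpxy then 2 else 0 := by
  cases i <;> rfl

theorem intPhases_timeBit_parity (i : RelIndex) :
    intPhases 1 (fun g h => timeBit g * parity h) i = if i = .Ttx then 1 else 0 := by
  cases i <;> rfl

theorem intPhases_timeBit_minusCount (i : RelIndex) :
    intPhases 1 (fun g h => timeBit g * minusCount h) i = if i = .Tpx then 1 else 0 := by
  cases i <;> rfl

theorem intPhases_timeBit_swapBit (i : RelIndex) :
    intPhases 1 (fun g h => timeBit g * swapBit h) i = if i = .Tpxy then 1 else 0 := by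
  cases i <;> rfl

/-! ### Signs -/

theorem mu_two_mul_self (a : mu 2) : a * a = 1 := by
  rw [← sq]
  exact Subtype.ext a.2

theorem mu_two_mul_self_mul (a b : mu 2) : a * (a * b) = b := by
  rw [← mul_assoc, mu_two_mul_self, one_mul]

theorem mu_two_zpow_two (a : mu 2) : a ^ (2 : ℤ) = 1 := by
  rw [zpow_two, mu_two_mul_self]

theorem nat_card_mu_two : Nat.card (mu 2) = 2 := by
  have hm : (-1 : Circle) ∈ mu 2 := by
    change (-1 : Circle) ^ 2 = 1
    exact neg_one_sq
  rw [Nat.card_eq_two_iff]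
  refine ⟨1, ⟨-1, hm⟩, ?_, ?_⟩
  · intro h
    have h' := congrArg (fun x : mu 2 => ((x : Circle) : ℂ)) h
    norm_num at h'
  · ext ⟨z, hz⟩
    have h2 : (z : ℂ) ^ 2 = 1 := by
      have hz' : z ^ 2 = 1 := hz
      rw [← Circle.coe_pow, hz', Circle.coe_one]
    simp only [Set.mem_insert_iff, Set.mem_singleton_iff, Set.mem_univ, iff_true]
    rw [sq, mul_self_eq_one_iff] at h2
    rcases h2 with h | h
    · exact Or.inl (Subtype.ext (Circle.ext (by simpa using h)))
    · exact Or.inr (Subtype.ext (Circle.ext (by simpa using h)))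

/-- The sign group is cyclic of order two. -/
noncomputable def muTwoEquiv : mu 2 ≃* Multiplicative (ZMod 2) :=
  mulEquivOfPrimeCardEq (p := 2) nat_card_mu_two (by simp)

/-! ### The invariants of `ℤ₂` factor sets -/

theorem phases_eq_mul {t : GPrime →* ℤˣ} {M : Type*} [CommGroup M] (ω : cocycles₂ t M)
    (a b c d : M) : phases ω a b c d = phases (1 : cocycles₂ t M) a b c d * phases ω 1 1 1 1 := by
  rw [← phases_mul]
  simp only [one_mul, mul_one]

theorem phases_mu_two (ω : cocycles₂ (1 : GPrime →* ℤˣ) (mu 2)) (a b c d : mu 2) :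
    phases ω a b c d = phases ω 1 1 1 1 := by
  have h4 : ∀ a : mu 2, a ^ 4 = 1 := fun a => by
    rw [show 4 = 2 * 2 from rfl, pow_mul, sq, mu_two_mul_self]
  rw [phases_eq_mul, mul_eq_right]
  funext i
  cases i <;> simp [phases, tyCoeff, mu_two_mul_self, h4, sq]

/-- The phases of the lifts with trivial coefficients. -/
def stdPhases (t : GPrime →* ℤˣ) (M : Type*) [CommGroup M] : cocycles₂ t M →* (RelIndex → M) where
  toFun ω := phases ω 1 1 1 1
  map_one' := by
    funext i
    cases i <;> simp [phases, tyCoeff]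
  map_mul' ω₁ ω₂ := by
    rw [← phases_mul]
    simp only [mul_one]

/-- The `ℤ₂` factor set `z ^ e(g, h)`. -/
noncomputable def signCocycle (z : mu 2) (e : GPrime → GPrime → ℤ) (he : IsIntCocycle 1 2 e) :
    cocycles₂ (1 : GPrime →* ℤˣ) (mu 2) :=
  zpowCocycle z (mu_two_zpow_two z) e he

theorem stdPhases_signCocycle (z : mu 2) (e : GPrime → GPrime → ℤ) (he : IsIntCocycle 1 2 e)
    (i : RelIndex) : stdPhases 1 (mu 2) (signCocycle z e he) i = z ^ intPhases 1 e i :=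
  phases_zpowCocycle z _ e he i

/-- A `ℤ₂` factor set with prescribed phases. The signs entering each factor undo the phases that
the other factors contribute to the same relation. -/
noncomputable def signRep (s : RelIndex → mu 2) : cocycles₂ (1 : GPrime →* ℤˣ) (mu 2) :=
  signCocycle (s .txty) areaExp isIntCocycle_areaExp.sign *
  signCocycle (s .typx * s .px) parityExp isIntCocycle_parityExp.sign *
  signCocycle (s .pxpxy) angleExp isIntCocycle_angleExp.sign *
  signCocycle (s .T) timeExp isIntCocycle_timeExp.sign *
  signCocycle (s .px) _ (isBit_minusCount.isIntCocycle_cup isBit_minusCount) *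
  signCocycle (s .px * s .txpx) _ (isBit_parity.isIntCocycle_cup isBit_parity) *
  signCocycle (s .pxy) _ (isBit_swapBit.isIntCocycle_cup isBit_swapBit) *
  signCocycle (s .Ttx) _ (isBit_timeBit.isIntCocycle_cup isBit_parity) *
  signCocycle (s .T * s .Tpx) _ (isBit_timeBit.isIntCocycle_cup isBit_minusCount) *
  signCocycle (s .T * s .Tpxy) _ (isBit_timeBit.isIntCocycle_cup isBit_swapBit)

theorem stdPhases_signRep (s : RelIndex → mu 2) : stdPhases 1 (mu 2) (signRep s) = s := by
  have h6 : ∀ a : mu 2, a ^ (6 : ℤ) = 1 := fun a => by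
    rw [show (6 : ℤ) = 2 * 3 from rfl, zpow_mul, mu_two_zpow_two, one_zpow]
  have h2 : ∀ a : mu 2, a ^ 2 = 1 := fun a => by rw [sq, mu_two_mul_self]
  funext i
  simp only [signRep, map_mul, Pi.mul_apply, stdPhases_signCocycle, intPhases_areaExp,
    intPhases_parityExp, intPhases_angleExp, intPhases_timeExp, intPhases_minusCount_minusCount,
    intPhases_parity_parity, intPhases_swapBit_swapBit, intPhases_timeBit_parity,
    intPhases_timeBit_minusCount, intPhases_timeBit_swapBit]
  cases i <;> simp [h6, h2, mul_assoc, mu_two_mul_self, mu_two_mul_self_mul]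

theorem ker_stdPhases_mu_two : (stdPhases 1 (mu 2)).ker = coboundaries₂ 1 (mu 2) := by
  ext ω
  rw [mem_coboundaries₂_iff_phases isReflectionTwist_one]
  simp only [phases_mu_two, exists_const]
  rfl

/-- The isomorphism sending a class to its ten phases. -/
noncomputable def sigmaEquiv : H2 (1 : GPrime →* ℤˣ) (mu 2) ≃* (RelIndex → mu 2) :=
  (QuotientGroup.quotientMulEquivOfEq ker_stdPhases_mu_two.symm).trans
    (QuotientGroup.quotientKerEquivOfSurjective (stdPhases 1 (mu 2)) fun s =>
      ⟨signRep s, stdPhases_signRep s⟩)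

theorem sigmaEquiv_cls (ω : cocycles₂ (1 : GPrime →* ℤˣ) (mu 2)) :
    sigmaEquiv (cls ω) = stdPhases 1 (mu 2) ω := rfl

/-! ### The invariants of twisted `U(1)` factor sets -/

namespace Extension

variable {G : Type*} [Group G] {t : G →* ℤˣ} {M : Type*} [CommGroup M] {ω : cocycles₂ t M}

theorem mul_incl (x : Extension ω) (m : M) :
    x * incl ω m = incl ω (m ^ (t x.elt : ℤ)) * x := by
  have h := ω.2 x.elt 1 1
  simp only [mul_one] at h
  rw [incl_mul]
  ext
  · simp only [mul_def, incl, MonoidHom.coe_mk, OneHom.coe_mk, mul_left_cancel h, mul_zpow,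
      inv_zpow]
    rw [mul_assoc, mul_assoc, inv_mul_cancel, mul_one, mul_comm]
  · simp [mul_def, incl]

theorem sq_eq_one_of_mul_self {x : Extension ω} {m : M} (hx : t x.elt = -1)
    (h : x ^ 2 = incl ω m) : m ^ 2 = 1 := by
  have h1 : incl ω m * x = incl ω m⁻¹ * x := by
    rw [← h, ← pow_succ, pow_succ', h, mul_incl, hx]
    simp
  have h2 := incl_injective (mul_right_cancel h1)
  rwa [eq_inv_iff_mul_eq_one, ← sq] at h2

theorem commutator_sq {x y : Extension ω} {c m : M} (hx : t x.elt = 1) (h : x ^ 2 = incl ω c)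
    (hxy : x * y = incl ω m * y * x) : m ^ 2 * c ^ (t y.elt : ℤ) = c := by
  apply incl_injective (ω := ω)
  apply mul_right_cancel (b := y)
  have hm : x * incl ω m = incl ω m * x := by
    rw [mul_incl, hx]
    simp
  symm
  calc incl ω c * y = x * (x * y) := by rw [← h, sq, mul_assoc]
    _ = incl ω m * (x * y) * x := by
      rw [hxy, mul_assoc, ← mul_assoc x, hm, mul_assoc, ← mul_assoc x, hxy]
      simp only [mul_assoc]
    _ = incl ω m * incl ω m * (y * x ^ 2) := by rw [hxy, sq]; simp only [mul_assoc]
    _ = incl ω (m ^ 2 * c ^ (t y.elt : ℤ)) * y := by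
      rw [h, mul_incl y, sq, map_mul, map_mul]
      simp only [mul_assoc]

end Extension

section Twisted

variable {M : Type*} [CommGroup M] (ω : cocycles₂ twist M)

theorem twist_Pxy : twist Pxy = -1 := by rw [isReflectionTwist_twist.Pxy, twist_Px]

theorem stdPhases_px_sq : stdPhases twist M ω .px ^ 2 = 1 :=
  Extension.sq_eq_one_of_mul_self (x := (mkLifts ω 1 1 1 1).px) twist_Px
    (mkLifts_realizes isReflectionTwist_twist ω 1 1 1 1).2.2.1

theorem stdPhases_txpx_sq : stdPhases twist M ω .txpx ^ 2 = 1 := by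
  refine Extension.sq_eq_one_of_mul_self
    (x := (mkLifts ω 1 1 1 1).tx * (mkLifts ω 1 1 1 1).px) ?_ ?_
  · change twist (Tx * Px) = -1
    rw [map_mul, isReflectionTwist_twist.Tx, twist_Px, one_mul]
  · rw [sq, ← mul_assoc]
    exact (mkLifts_realizes isReflectionTwist_twist ω 1 1 1 1).2.2.2.1

theorem stdPhases_pxy_sq : stdPhases twist M ω .pxy ^ 2 = 1 :=
  Extension.sq_eq_one_of_mul_self (x := (mkLifts ω 1 1 1 1).pxy) twist_Pxy
    (mkLifts_realizes isReflectionTwist_twist ω 1 1 1 1).2.2.2.2.1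

theorem stdPhases_Ttx_sq : stdPhases twist M ω .Ttx ^ 2 = 1 := by
  obtain ⟨-, -, -, -, -, -, h7, h8, -, -⟩ := mkLifts_realizes isReflectionTwist_twist ω 1 1 1 1
  have h := Extension.commutator_sq isReflectionTwist_twist.Tr h7 h8
  rw [show twist (mkLifts ω 1 1 1 1).tx.elt = 1 from isReflectionTwist_twist.Tx] at h
  rw [Units.val_one, zpow_one, mul_eq_right] at h
  exact h

theorem stdPhases_Tpx_sq : stdPhases twist M ω .Tpx ^ 2 = stdPhases twist M ω .T ^ 2 := by
  obtain ⟨-, -, -, -, -, -, h7, -, h9, -⟩ := mkLifts_realizes isReflectionTwist_twist ω 1 1 1 1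
  have h := Extension.commutator_sq isReflectionTwist_twist.Tr h7 h9
  rw [show twist (mkLifts ω 1 1 1 1).px.elt = -1 from twist_Px, Units.val_neg, Units.val_one,
    zpow_neg_one, mul_inv_eq_iff_eq_mul, ← sq] at h
  exact h

theorem stdPhases_Tpxy_sq : stdPhases twist M ω .Tpxy ^ 2 = stdPhases twist M ω .T ^ 2 := by
  obtain ⟨-, -, -, -, -, -, h7, -, -, h10⟩ := mkLifts_realizes isReflectionTwist_twist ω 1 1 1 1
  have h := Extension.commutator_sq isReflectionTwist_twist.Tr h7 h10
  rw [show twist (mkLifts ω 1 1 1 1).pxy.elt = -1 from twist_Pxy, Units.val_neg, Units.val_one,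
    zpow_neg_one, mul_inv_eq_iff_eq_mul, ← sq] at h
  exact h

/-- The effect on the phases of multiplying the lifts by elements of the coefficient group. -/
theorem phases_one_twist (a b c d : M) (i : RelIndex) :
    phases (1 : cocycles₂ twist M) a b c d i = match i with
      | .typx => (a ^ 2)⁻¹
      | .pxpxy => (c / b) ^ 4
      | .T => d ^ 2
      | .Tpx => d ^ 2
      | .Tpxy => d ^ 2
      | _ => 1 := by
  cases i <;> simp [phases, tyCoeff, twist_Px, sq, div_eq_mul_inv]

end Twisted

/-- The invariants of a twisted `U(1)` factor set. The quotients by the phase of `T` make the last two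
independent of the lift of time reversal. -/
noncomputable def torInvariants : cocycles₂ twist Circle →* Circle × (TorIndex → mu 2) where
  toFun ω := (stdPhases twist Circle ω .txty, fun
    | .px => ⟨stdPhases twist Circle ω .px, stdPhases_px_sq ω⟩
    | .txpx => ⟨stdPhases twist Circle ω .txpx, stdPhases_txpx_sq ω⟩
    | .pxy => ⟨stdPhases twist Circle ω .pxy, stdPhases_pxy_sq ω⟩
    | .Ttx => ⟨stdPhases twist Circle ω .Ttx, stdPhases_Ttx_sq ω⟩
    | .Tpx => ⟨stdPhases twist Circle ω .Tpx / stdPhases twist Circle ω .T, by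
        change (_ : Circle) ^ 2 = 1
        rw [div_pow, stdPhases_Tpx_sq, div_self']⟩
    | .Tpxy => ⟨stdPhases twist Circle ω .Tpxy / stdPhases twist Circle ω .T, by
        change (_ : Circle) ^ 2 = 1
        rw [div_pow, stdPhases_Tpxy_sq, div_self']⟩)
  map_one' := by
    refine Prod.ext ?_ (funext fun i => ?_)
    · simp
    · cases i <;> apply Subtype.ext <;> simp
  map_mul' ω₁ ω₂ := by
    refine Prod.ext ?_ (funext fun i => ?_)
    · simp
    · cases i <;> apply Subtype.ext <;> simp [mul_div_mul_comm]

/-- The gauge conditions force all phases to take their invariant values. -/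
theorem phases_eq_gaugeFixed_iff (ω : cocycles₂ twist Circle) (a b c d : Circle) :
    phases ω a b c d = gaugeFixed (torInvariants ω) ↔
      phases ω a b c d .typx = 1 ∧ phases ω a b c d .pxpxy = 1 ∧ phases ω a b c d .T = 1 := by
  constructor
  · intro h
    rw [h]
    exact ⟨rfl, rfl, rfl⟩
  · rintro ⟨h1, h2, h3⟩
    have hT : d ^ 2 = (stdPhases twist Circle ω .T)⁻¹ := by
      rw [phases_eq_mul, Pi.mul_apply, phases_one_twist] at h3
      exact eq_inv_of_mul_eq_one_left h3
    funext i
    cases i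
    case typx => exact h1
    case pxpxy => exact h2
    case T => exact h3
    case Tpx =>
      rw [phases_eq_mul, Pi.mul_apply, phases_one_twist, hT, mul_comm, ← div_eq_mul_inv]
      rfl
    case Tpxy =>
      rw [phases_eq_mul, Pi.mul_apply, phases_one_twist, hT, mul_comm, ← div_eq_mul_inv]
      rfl
    all_goals
      rw [phases_eq_mul, Pi.mul_apply, phases_one_twist, one_mul]
      rfl

theorem Circle.exists_pow_eq (z : Circle) {n : ℕ} (hn : n ≠ 0) : ∃ w : Circle, w ^ n = z := by
  refine ⟨Circle.exp (Complex.arg z / n), ?_⟩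
  rw [← Circle.exp_nsmul, nsmul_eq_mul, mul_div_cancel₀ _ (Nat.cast_ne_zero.2 hn), Circle.exp_arg]

/-- Lifts obeying the gauge conditions exist, because `U(1)` is divisible. -/
theorem exists_phases_eq_gaugeFixed (ω : cocycles₂ twist Circle) :
    ∃ a b c d, phases ω a b c d = gaugeFixed (torInvariants ω) := by
  obtain ⟨a, ha⟩ := Circle.exists_pow_eq (stdPhases twist Circle ω .typx) two_ne_zero
  obtain ⟨c, hc⟩ := Circle.exists_pow_eq (stdPhases twist Circle ω .pxpxy)⁻¹ four_ne_zero
  obtain ⟨d, hd⟩ := Circle.exists_pow_eq (stdPhases twist Circle ω .T)⁻¹ two_ne_zero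
  refine ⟨a, 1, c, d, (phases_eq_gaugeFixed_iff _ _ _ _ _).2 ⟨?_, ?_, ?_⟩⟩ <;>
    rw [phases_eq_mul, Pi.mul_apply, phases_one_twist]
  · dsimp only
    rw [ha]
    exact inv_mul_cancel _
  · dsimp only
    rw [div_one, hc]
    exact inv_mul_cancel _
  · dsimp only
    rw [hd]
    exact inv_mul_cancel _

theorem gaugeFixed_one : gaugeFixed 1 = 1 := by
  funext i
  cases i <;> rfl

theorem gaugeFixed_injective : Function.Injective gaugeFixed := by
  intro p q h
  refine Prod.ext (congrFun h .txty) (funext fun i => Subtype.ext ?_)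
  cases i
  · exact congrFun h .px
  · exact congrFun h .txpx
  · exact congrFun h .pxy
  · exact congrFun h .Ttx
  · exact congrFun h .Tpx
  · exact congrFun h .Tpxy

theorem ker_torInvariants : torInvariants.ker = coboundaries₂ twist Circle := by
  ext ω
  rw [mem_coboundaries₂_iff_phases isReflectionTwist_twist, MonoidHom.mem_ker]
  constructor
  · intro h
    obtain ⟨a, b, c, d, h'⟩ := exists_phases_eq_gaugeFixed ω
    rw [h, gaugeFixed_one] at h'
    exact ⟨a, b, c, d, h'⟩
  · rintro ⟨a, b, c, d, h⟩
    have h' := (phases_eq_gaugeFixed_iff ω a b c d).2 (by rw [h]; exact ⟨rfl, rfl, rfl⟩)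
    rw [h, ← gaugeFixed_one] at h'
    exact (gaugeFixed_injective h').symm

/-! ### Change of coefficients -/

/-- The phases are natural in the coefficient group and the twist. -/
theorem stdPhases_map {t t' : GPrime →* ℤˣ} {M M' : Type*} [CommGroup M] [CommGroup M']
    (f : M →* M') (hf : ∀ m, f (m ^ (t Px : ℤ)) = f m ^ (t' Px : ℤ)) (ω : cocycles₂ t M)
    (ω' : cocycles₂ t' M') (h : ∀ p, ω'.1 p = f (ω.1 p)) (i : RelIndex) :
    stdPhases t' M' ω' i = f (stdPhases t M ω i) := by
  cases i <;>
    simp only [stdPhases, phases, tyCoeff, MonoidHom.coe_mk, OneHom.coe_mk, h, map_mul f, map_div,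
      map_pow, one_zpow, one_mul, mul_one, one_pow, div_one, hf]

theorem stdPhases_inclCocycles (ω : cocycles₂ (1 : GPrime →* ℤˣ) (mu 2)) (i : RelIndex) :
    stdPhases twist Circle (inclCocycles twist ω) i = (stdPhases 1 (mu 2) ω i : Circle) := by
  refine stdPhases_map (mu 2).subtype (fun m => ?_) ω _ (fun _ => rfl) i
  exact (congrArg Subtype.val (zpow_one m)).trans (mu_two_zpow m _).symm

theorem mu_two_div (a b : mu 2) : a / b = b * a := by
  rw [div_eq_mul_inv, inv_eq_of_mul_eq_one_right (mu_two_mul_self b), mul_comm]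

theorem torInvariants_inclCocycles (ω : cocycles₂ (1 : GPrime →* ℤˣ) (mu 2)) :
    torInvariants (inclCocycles twist ω) = ((stdPhases 1 (mu 2) ω .txty : Circle), fun
      | .px => stdPhases 1 (mu 2) ω .px
      | .txpx => stdPhases 1 (mu 2) ω .txpx
      | .pxy => stdPhases 1 (mu 2) ω .pxy
      | .Ttx => stdPhases 1 (mu 2) ω .Ttx
      | .Tpx => stdPhases 1 (mu 2) ω .T * stdPhases 1 (mu 2) ω .Tpx
      | .Tpxy => stdPhases 1 (mu 2) ω .T * stdPhases 1 (mu 2) ω .Tpxy) := by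
  refine Prod.ext (stdPhases_inclCocycles ω .txty) (funext fun i => Subtype.ext ?_)
  cases i <;> dsimp only
  case Tpx =>
    rw [← mu_two_div, Subgroup.coe_div, ← stdPhases_inclCocycles, ← stdPhases_inclCocycles]
    rfl
  case Tpxy =>
    rw [← mu_two_div, Subgroup.coe_div, ← stdPhases_inclCocycles, ← stdPhases_inclCocycles]
    rfl
  all_goals
    rw [← stdPhases_inclCocycles]
    rfl

/-- The continuous invariant is realized by the area exponent, and the signs by `ℤ₂` factor sets. -/
theorem torInvariants_surjective : Function.Surjective torInvariants := by
  rintro ⟨z, s⟩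
  let ω₁ : cocycles₂ twist Circle := zpowCocycle z (zpow_zero z) areaExp isIntCocycle_areaExp
  let σ : RelIndex → mu 2
    | .px => s .px
    | .txpx => s .txpx
    | .pxy => s .pxy
    | .Ttx => s .Ttx
    | .Tpx => s .Tpx
    | .Tpxy => s .Tpxy
    | _ => 1
  have h₁ : ∀ i, stdPhases twist Circle ω₁ i = z ^ (if i = .txty then 1 else 0 : ℤ) := fun i => by
    rw [← intPhases_areaExp]
    exact phases_zpowCocycle z (zpow_zero z) areaExp isIntCocycle_areaExp i
  refine ⟨ω₁ * inclCocycles twist (signRep σ), ?_⟩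
  rw [map_mul, torInvariants_inclCocycles, stdPhases_signRep]
  refine Prod.ext ?_ (funext fun i => Subtype.ext ?_)
  · simp [torInvariants, h₁, σ]
  · cases i <;> simp [torInvariants, h₁, σ]

/-- The isomorphism sending a twisted `U(1)` class to its invariants. -/
noncomputable def alphaEquiv : H2 twist Circle ≃* Circle × (TorIndex → mu 2) :=
  (QuotientGroup.quotientMulEquivOfEq ker_torInvariants.symm).trans
    (QuotientGroup.quotientKerEquivOfSurjective torInvariants torInvariants_surjective)

theorem alphaEquiv_cls (ω : cocycles₂ twist Circle) : alphaEquiv (cls ω) = torInvariants ω := rfl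

theorem alphaEquiv_rho2 (c : H2 (1 : GPrime →* ℤˣ) (mu 2)) :
    alphaEquiv (rho2 twist c) = ((sigmaEquiv c .txty : Circle), fun
      | .px => sigmaEquiv c .px
      | .txpx => sigmaEquiv c .txpx
      | .pxy => sigmaEquiv c .pxy
      | .Ttx => sigmaEquiv c .Ttx
      | .Tpx => sigmaEquiv c .T * sigmaEquiv c .Tpx
      | .Tpxy => sigmaEquiv c .T * sigmaEquiv c .Tpxy) := by
  induction c using QuotientGroup.induction_on with
  | H ω => exact torInvariants_inclCocycles ω

/-! ### Anomaly-negative factor sets -/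

/-- The `n`-th power map from the `2n`-th roots of unity to the signs. -/
noncomputable def muPow (n : ℕ) : mu (2 * n) →* mu 2 where
  toFun z := ⟨(z : Circle) ^ n, by
    change (_ : Circle) ^ 2 = 1
    rw [← pow_mul, mul_comm n 2]
    exact z.2⟩
  map_one' := Subtype.ext (one_pow n)
  map_mul' a b := Subtype.ext (mul_pow _ _ n)

theorem muPow_surjective {n : ℕ} (hn : n ≠ 0) : Function.Surjective (muPow n) := by
  intro s
  obtain ⟨w, hw⟩ := Circle.exists_pow_eq (s : Circle) hn
  refine ⟨⟨w, ?_⟩, Subtype.ext hw⟩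
  change w ^ (2 * n) = 1
  rw [mul_comm, pow_mul, hw]
  exact s.2

/-- The condition on the ten phases that characterizes anomaly-negative factor sets. -/
def IsNegativePhases (s : RelIndex → mu 2) : Prop :=
  s .px = 1 ∧ s .txpx = 1 ∧ s .pxy = 1 ∧ s .Ttx = 1 ∧ s .T * s .Tpx = 1 ∧ s .T * s .Tpxy = 1

theorem zpow_twist_Px (a : mu 2) : a ^ (twist Px : ℤ) = a := Subtype.ext (mu_two_zpow a _)

/-- Already the test with fourth roots of unity forces the six conditions: the twisted phases that
square to `1` disappear in the square. -/
theorem IsAnomalyNegative.isNegativePhases {ω : cocycles₂ (1 : GPrime →* ℤˣ) (mu 2)}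
    (h : IsAnomalyNegative twist ω) : IsNegativePhases (stdPhases 1 (mu 2) ω) := by
  obtain ⟨φ, hφ⟩ := h 2 le_rfl even_two
  have key : ∀ i, stdPhases 1 (mu 2) ω i = muPow 2 (stdPhases twist (mu (2 * 2)) φ i) := by
    refine stdPhases_map (muPow 2) (fun m => ?_) φ ω fun p => Subtype.ext (hφ p.1 p.2)
    rw [map_zpow, zpow_twist_Px]
    exact (zpow_one _).symm
  have hsq : ∀ m : mu (2 * 2), m ^ 2 = 1 → muPow 2 m = 1 := fun m hm =>
    Subtype.ext (show (m : Circle) ^ 2 = 1 from congrArg Subtype.val hm)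
  have hsq' : ∀ m k : mu (2 * 2), k ^ 2 = m ^ 2 → muPow 2 m * muPow 2 k = 1 := fun m k hm => by
    rw [show muPow 2 k = muPow 2 m from
      Subtype.ext (show (k : Circle) ^ 2 = (m : Circle) ^ 2 from congrArg Subtype.val hm),
      mu_two_mul_self]
  simp only [IsNegativePhases, key]
  exact ⟨hsq _ (stdPhases_px_sq φ), hsq _ (stdPhases_txpx_sq φ), hsq _ (stdPhases_pxy_sq φ),
    hsq _ (stdPhases_Ttx_sq φ), hsq' _ _ (stdPhases_Tpx_sq φ), hsq' _ _ (stdPhases_Tpxy_sq φ)⟩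

/-- A factor set with the six conditions is cohomologous to a product of factor sets `s ^ e(g, h)`
with `e` an integer-valued twisted factor set; extracting an `n`-th root of each sign `s`, and of a
trivializing cochain, solves the test for `n`. -/
theorem isAnomalyNegative_of_isNegativePhases {ω : cocycles₂ (1 : GPrime →* ℤˣ) (mu 2)}
    (h : IsNegativePhases (stdPhases 1 (mu 2) ω)) : IsAnomalyNegative twist ω := by
  intro n hn _
  have hn0 : n ≠ 0 := by omega
  set s := stdPhases 1 (mu 2) ω with hs
  obtain ⟨h1, h2, h3, h4, h5, h6⟩ := h
  have hmem : ω / signRep s ∈ coboundaries₂ 1 (mu 2) := by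
    rw [← ker_stdPhases_mu_two, MonoidHom.mem_ker, map_div, stdPhases_signRep, ← hs, div_self']
  obtain ⟨l, hl⟩ := hmem
  choose r hr using muPow_surjective hn0
  let ψ (i : RelIndex) (e : GPrime → GPrime → ℤ) (he : IsIntCocycle twist 0 e) :
    cocycles₂ twist (mu (2 * n)) := zpowCocycle (r (s i)) (zpow_zero _) e he
  have hψ : ∀ i e he p, muPow n ((ψ i e he).1 p) = s i ^ e p.1 p.2 := by
    intro i e he p
    change muPow n (r (s i) ^ e p.1 p.2) = _
    rw [map_zpow, hr]
  let δ : cocycles₂ twist (mu (2 * n)) := ⟨coboundary₁ twist _ fun g => r (l g), by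
    intro g h k
    simp only [coboundary₁, MonoidHom.coe_mk, OneHom.coe_mk, mul_zpow, inv_zpow, map_mul,
      Units.val_mul, zpow_mul, mul_assoc, ← zpow_mul _ (twist h : ℤ), mul_comm (twist h : ℤ)]
    apply Additive.ofMul.injective
    simp only [ofMul_mul, ofMul_inv, ofMul_zpow]
    module⟩
  have hδ : ∀ p, muPow n (δ.1 p) = ω.1 p / (signRep s).1 p := by
    intro p
    have hp : coboundary₁ 1 (mu 2) l p = ω.1 p / (signRep s).1 p := congrFun hl p
    rw [← hp]
    change muPow n (r (l p.1) * r (l p.2) ^ (twist p.1 : ℤ) * (r (l (p.1 * p.2)))⁻¹) =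
      l p.1 * l p.2 ^ (1 : ℤ) * (l (p.1 * p.2))⁻¹
    rw [map_mul, map_mul, map_inv, map_zpow, hr, hr, hr, zpow_one,
      show l p.2 ^ (twist p.1 : ℤ) = l p.2 from Subtype.ext (mu_two_zpow _ _)]
  refine ⟨δ * (ψ .txty areaExp isIntCocycle_areaExp * ψ .typx parityExp isIntCocycle_parityExp *
    ψ .pxpxy angleExp isIntCocycle_angleExp * ψ .T timeExp isIntCocycle_timeExp), fun g k => ?_⟩
  have hrep : (signRep s).1 (g, k) = s .txty ^ areaExp g k * s .typx ^ parityExp g k *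
      s .pxpxy ^ angleExp g k * s .T ^ timeExp g k := by
    simp [signRep, h1, h2, h3, h4, h5, h6, signCocycle, zpowCocycle]
  refine congrArg Subtype.val
    (?_ : ω.1 (g, k) = muPow n ((δ * (_ * _ * _ * _) : cocycles₂ twist (mu (2 * n))).1 (g, k)))
  simp only [Subgroup.coe_mul, Pi.mul_apply, map_mul, hδ, hψ]
  rw [hrep, div_mul_cancel]

theorem isAnomalyNegative_iff (ω : cocycles₂ (1 : GPrime →* ℤˣ) (mu 2)) :
    IsAnomalyNegative twist ω ↔ IsNegativePhases (stdPhases 1 (mu 2) ω) :=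
  ⟨fun h => h.isNegativePhases, isAnomalyNegative_of_isNegativePhases⟩

theorem cls_mem_anomalyNegative_iff (ω : cocycles₂ (1 : GPrime →* ℤˣ) (mu 2)) :
    cls ω ∈ anomalyNegative twist ↔ IsAnomalyNegative twist ω := by
  constructor
  · rintro ⟨ω', hω', h⟩
    have h' : stdPhases 1 (mu 2) ω' = stdPhases 1 (mu 2) ω := congrArg sigmaEquiv h
    rw [isAnomalyNegative_iff, ← h', ← isAnomalyNegative_iff]
    exact hω'
  · intro h
    exact ⟨ω, h, rfl⟩

theorem mem_anomalyNegative_iff (c : H2 (1 : GPrime →* ℤˣ) (mu 2)) :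
    c ∈ anomalyNegative twist ↔ IsNegativePhases (sigmaEquiv c) := by
  induction c using QuotientGroup.induction_on with
  | H ω => exact (cls_mem_anomalyNegative_iff ω).trans (isAnomalyNegative_iff ω)

/-! ### The groups `𝒩` and `𝒮` -/

/-- The six signs that distinguish the classes modulo the anomaly-negative ones. -/
noncomputable def torSigns : H2 (1 : GPrime →* ℤˣ) (mu 2) →* (TorIndex → mu 2) :=
  (MonoidHom.snd Circle (TorIndex → mu 2)).comp (alphaEquiv.toMonoidHom.comp (rho2 twist))

theorem torSigns_eq (c : H2 (1 : GPrime →* ℤˣ) (mu 2)) :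
    torSigns c = (alphaEquiv (rho2 twist c)).2 := rfl

theorem ker_torSigns : torSigns.ker = anomalyNegative twist := by
  ext c
  rw [MonoidHom.mem_ker, mem_anomalyNegative_iff, torSigns_eq, alphaEquiv_rho2]
  constructor
  · intro h
    exact ⟨congrFun h .px, congrFun h .txpx, congrFun h .pxy, congrFun h .Ttx, congrFun h .Tpx,
      congrFun h .Tpxy⟩
  · rintro ⟨h1, h2, h3, h4, h5, h6⟩
    funext i
    cases i
    exacts [h1, h2, h3, h4, h5, h6]

theorem torSigns_surjective : Function.Surjective torSigns := by
  intro s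
  let σ : RelIndex → mu 2
    | .px => s .px
    | .txpx => s .txpx
    | .pxy => s .pxy
    | .Ttx => s .Ttx
    | .Tpx => s .Tpx
    | .Tpxy => s .Tpxy
    | _ => 1
  refine ⟨sigmaEquiv.symm σ, ?_⟩
  rw [torSigns_eq, alphaEquiv_rho2, MulEquiv.apply_symm_apply]
  funext i
  cases i <;> simp [σ]

/-- The four free signs of an anomaly-negative class. -/
noncomputable def negativeSigns : anomalyNegative twist →* (Fin 4 → mu 2) where
  toFun c := ![sigmaEquiv c.1 .txty, sigmaEquiv c.1 .typx, sigmaEquiv c.1 .pxpxy, sigmaEquiv c.1 .T]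
  map_one' := by
    funext i
    fin_cases i <;> simp
  map_mul' c₁ c₂ := by
    funext i
    fin_cases i <;> simp

theorem negativeSigns_bijective : Function.Bijective negativeSigns := by
  constructor
  · rw [injective_iff_map_eq_one]
    intro c hc
    obtain ⟨h1, h2, h3, h4, h5, h6⟩ := (mem_anomalyNegative_iff c.1).1 c.2
    have hT : sigmaEquiv c.1 .T = 1 := congrFun hc 3
    rw [hT, one_mul] at h5 h6
    apply Subtype.ext
    apply sigmaEquiv.injective
    rw [OneMemClass.coe_one, map_one]
    funext i
    cases i
    exacts [congrFun hc 0, congrFun hc 1, h1, h2, h3, congrFun hc 2, hT, h4, h5, h6]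
  · intro s
    let σ : RelIndex → mu 2
      | .txty => s 0
      | .typx => s 1
      | .pxpxy => s 2
      | .T => s 3
      | .Tpx => s 3
      | .Tpxy => s 3
      | _ => 1
    refine ⟨⟨sigmaEquiv.symm σ, ?_⟩, ?_⟩
    · rw [mem_anomalyNegative_iff, MulEquiv.apply_symm_apply]
      exact ⟨rfl, rfl, rfl, rfl, mu_two_mul_self _, mu_two_mul_self _⟩
    · funext i
      simp only [negativeSigns, MonoidHom.coe_mk, OneHom.coe_mk, MulEquiv.apply_symm_apply]
      fin_cases i <;> rfl

/-- An enumeration of the labels of the ten phases. -/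
def relIndexEquiv : RelIndex ≃ Fin 10 where
  toFun
    | .txty => 0 | .typx => 1 | .px => 2 | .txpx => 3 | .pxy => 4 | .pxpxy => 5 | .T => 6
    | .Ttx => 7 | .Tpx => 8 | .Tpxy => 9
  invFun := ![.txty, .typx, .px, .txpx, .pxy, .pxpxy, .T, .Ttx, .Tpx, .Tpxy]
  left_inv i := by cases i <;> rfl
  right_inv i := by fin_cases i <;> rfl

/-- An enumeration of the labels of the six signs. -/
def torIndexEquiv : TorIndex ≃ Fin 6 where
  toFun
    | .px => 0 | .txpx => 1 | .pxy => 2 | .Ttx => 3 | .Tpx => 4 | .Tpxy => 5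
  invFun := ![.px, .txpx, .pxy, .Ttx, .Tpx, .Tpxy]
  left_inv i := by cases i <;> rfl
  right_inv i := by fin_cases i <;> rfl

end FluxFusion


theorem mainTheorem7 :
    Nonempty (H2 (1 : GPrime →* ℤˣ) (mu 2) ≃* (Fin 10 → Multiplicative (ZMod 2))) ∧
    Nonempty (H2 twist Circle ≃* Circle × (Fin 6 → Multiplicative (ZMod 2))) ∧
    Nonempty (anomalyNegative twist ≃* (Fin 4 → Multiplicative (ZMod 2))) ∧
    Nonempty ((H2 (1 : GPrime →* ℤˣ) (mu 2) ⧸ anomalyNegative twist) ≃*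
      (Fin 6 → Multiplicative (ZMod 2))) ∧
    (∀ ω : cocycles₂ (1 : GPrime →* ℤˣ) (mu 2),
      cls ω ∈ anomalyNegative twist ↔ IsAnomalyNegative twist ω) ∧
    ∃ (σ : H2 (1 : GPrime →* ℤˣ) (mu 2) ≃* (RelIndex → mu 2))
      (α : H2 twist Circle ≃* Circle × (TorIndex → mu 2)),
      (∀ ω : cocycles₂ (1 : GPrime →* ℤˣ) (mu 2),
        Nonempty (GeneratorLifts ω) ∧
        ∀ L : GeneratorLifts ω, L.Realizes (σ (cls ω))) ∧
      (∀ ω : cocycles₂ twist Circle,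
        (∃ L : GeneratorLifts ω, L.Realizes (gaugeFixed (α (cls ω)))) ∧
        ∀ (L : GeneratorLifts ω) (β : RelIndex → Circle),
          L.Realizes β → β .typx = 1 → β .pxpxy = 1 → β .T = 1 →
            β = gaugeFixed (α (cls ω))) ∧
      (∀ c : H2 (1 : GPrime →* ℤˣ) (mu 2),
        (α (rho2 twist c)).1 = (σ c .txty : Circle) ∧
        (α (rho2 twist c)).2 .px = σ c .px ∧
        (α (rho2 twist c)).2 .txpx = σ c .txpx ∧
        (α (rho2 twist c)).2 .pxy = σ c .pxy ∧
        (α (rho2 twist c)).2 .Ttx = σ c .Ttx ∧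
        (α (rho2 twist c)).2 .Tpx = σ c .T * σ c .Tpx ∧
        (α (rho2 twist c)).2 .Tpxy = σ c .T * σ c .Tpxy) ∧
      (∀ c : H2 (1 : GPrime →* ℤˣ) (mu 2),
        c ∈ anomalyNegative twist ↔
          σ c .px = 1 ∧ σ c .txpx = 1 ∧ σ c .pxy = 1 ∧ σ c .Ttx = 1 ∧
          σ c .T * σ c .Tpx = 1 ∧ σ c .T * σ c .Tpxy = 1) := by
  refine ⟨⟨sigmaEquiv.trans (MulEquiv.arrowCongr relIndexEquiv muTwoEquiv)⟩,
    ⟨alphaEquiv.trans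
      ((MulEquiv.refl Circle).prodCongr (MulEquiv.arrowCongr torIndexEquiv muTwoEquiv))⟩,
    ⟨(MulEquiv.ofBijective negativeSigns negativeSigns_bijective).trans
      (MulEquiv.arrowCongr (Equiv.refl _) muTwoEquiv)⟩,
    ⟨((QuotientGroup.quotientMulEquivOfEq ker_torSigns.symm).trans
      (QuotientGroup.quotientKerEquivOfSurjective torSigns torSigns_surjective)).trans
      (MulEquiv.arrowCongr torIndexEquiv muTwoEquiv)⟩,
    cls_mem_anomalyNegative_iff, sigmaEquiv, alphaEquiv, ?_, ?_, ?_, mem_anomalyNegative_iff⟩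
  · intro ω
    refine ⟨⟨mkLifts ω 1 1 1 1⟩, fun L => ?_⟩
    obtain ⟨a, b, c, d, rfl⟩ := L.exists_eq_mkLifts
    rw [sigmaEquiv_cls]
    change (mkLifts ω a b c d).Realizes (phases ω 1 1 1 1)
    rw [← phases_mu_two ω a b c d]
    exact mkLifts_realizes isReflectionTwist_one ω a b c d
  · intro ω
    rw [alphaEquiv_cls]
    constructor
    · obtain ⟨a, b, c, d, h⟩ := exists_phases_eq_gaugeFixed ω
      refine ⟨mkLifts ω a b c d, ?_⟩
      rw [← h]
      exact mkLifts_realizes isReflectionTwist_twist ω a b c d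
    · intro L β hβ h1 h2 h3
      obtain ⟨a, b, c, d, rfl⟩ := L.exists_eq_mkLifts
      obtain rfl := hβ.unique (mkLifts_realizes isReflectionTwist_twist ω a b c d)
      exact (phases_eq_gaugeFixed_iff ω a b c d).2 ⟨h1, h2, h3⟩
  · intro c
    rw [alphaEquiv_rho2]
    exact ⟨rfl, rfl, rfl, rfl, rfl, rfl, rfl⟩
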